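/- Identify the circle with $\mathbf S^1=\mathbf R/\mathbf Z\subset \mathbf C/\mathbf Z$, and let $\mathrm{Diff}^\omega(\mathbf S^1)$ be the group of real-analytic diffeomorphisms of $\mathbf S^1$ (preserving orientation or not). Let $G\subset \mathrm{Diff}^\omega(\mathbf S^1)$ be a finitely generated subgroup such that 1. ($G$ is expanding) for every $x\in\mathbf S^1$ there is $g\in G$ with $\log|Dg(x)|>0$; 2. ($G$ is locally discrete in the analytic category) there is a point $x\in\mathbf S^1$ for which there do not exist an open neighbourhood $V\subset\mathbf C/\mathbf Z$ of $x$ and a sequence $(g_n)$ of elements of $G\setminus\{\mathrm{id}\}$ that extend to univalent (i.e. injective) holomorphic maps $V\to\mathbf C/\mathbf Z$ converging uniformly on $V$ to the identity. Then $G$ is Gromov hyperbolic: for every finite symmetric generating set $S$ of $G$, there is a constant $\delta>0$ such that in the Cayley graph of $(G,S)$ (vertices the elements of $G$, edges the pairs $\{g,sg\}$ with $g\in G$, $s\in S$), for all $g_1,g_2,g_3\in G$ and all geodesics $[g_1,g_2]$, $[g_2,g_3]$, $[g_1,g_3]$, every vertex of $[g_1,g_3]$ is at distance less than $\delta$ from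 a vertex of $[g_1,g_2]$ or of $[g_2,g_3]$. -/

import Mathlib

open Topology Filter Set

noncomputable section

namespace CircleDyn

/-- `𝕜 / ℤ`. For `𝕜 = ℝ` this is the circle `S¹ = ℝ / ℤ`, for `𝕜 = ℂ` it is the cylinder
`ℂ / ℤ`, both with their quotient topology and quotient norm. -/
abbrev ModInt (𝕜 : Type) [NontriviallyNormedField 𝕜] : Type := AddCircle (1 : 𝕜)

/-- The circle `ℝ / ℤ`. -/
abbrev S1 : Type := ModInt ℝ

/-- The Riemann surface `ℂ / ℤ`. -/
abbrev Cyl : Type := ModInt ℂ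

/-- The inclusion of the circle `ℝ / ℤ` into `ℂ / ℤ`. -/
def incl : S1 →+ Cyl :=
  QuotientAddGroup.map (AddSubgroup.zmultiples (1 : ℝ)) (AddSubgroup.zmultiples (1 : ℂ))
    Complex.ofRealHom.toAddMonoidHom (by
      rintro _ ⟨n, rfl⟩
      exact ⟨n, by simp⟩)

theorem incl_coe (t : ℝ) : incl (t : S1) = ((t : ℂ) : Cyl) := rfl

/-- A map `f : 𝕜 / ℤ → 𝕜 / ℤ` is analytic at `x` when, near each representative of `x`,
it is induced by a map `F : 𝕜 → 𝕜` that is analytic there; that is, `f` is analytic at `x`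
in the local charts given by the projection `𝕜 → 𝕜 / ℤ`. -/
def AnalyticAtMod {𝕜 : Type} [NontriviallyNormedField 𝕜] (f : ModInt 𝕜 → ModInt 𝕜)
    (x : ModInt 𝕜) : Prop :=
  ∀ t : 𝕜, (t : ModInt 𝕜) = x →
    ∃ F : 𝕜 → 𝕜, AnalyticAt 𝕜 F t ∧ ∀ᶠ u : 𝕜 in 𝓝 t, f (u : ModInt 𝕜) = (F u : ModInt 𝕜)

theorem AnalyticAtMod.id {𝕜 : Type} [NontriviallyNormedField 𝕜] (x : ModInt 𝕜) :
    AnalyticAtMod (fun y => y) x :=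
  fun _ _ => ⟨fun u => u, analyticAt_id, Eventually.of_forall fun _ => rfl⟩

theorem AnalyticAtMod.comp {𝕜 : Type} [NontriviallyNormedField 𝕜] {f g : ModInt 𝕜 → ModInt 𝕜}
    {x : ModInt 𝕜} (hf : AnalyticAtMod f (g x)) (hg : AnalyticAtMod g x) :
    AnalyticAtMod (fun y => f (g y)) x := by
  rintro t rfl
  obtain ⟨F, hF, hgF⟩ := hg t rfl
  obtain ⟨H, hH, hfH⟩ := hf (F t) hgF.self_of_nhds.symm
  refine ⟨H ∘ F, hH.comp hF, ?_⟩
  filter_upwards [hgF, hF.continuousAt.eventually hfH] with u h1 h2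
  rw [h1, h2, Function.comp]

/-- The group `Diff^ω(S¹)`: all bijections `g` of the circle such that `g` and `g⁻¹` are real
analytic at every point. The group law is composition. Orientation is not required to be
preserved. -/
def analyticDiffeos : Subgroup (Equiv.Perm S1) where
  carrier := {g | (∀ x, AnalyticAtMod (𝕜 := ℝ) g x) ∧ ∀ x, AnalyticAtMod (𝕜 := ℝ) (g⁻¹ : Equiv.Perm S1) x}
  one_mem' := ⟨fun x => AnalyticAtMod.id x, fun x => AnalyticAtMod.id x⟩
  mul_mem' := by
    rintro a b ⟨ha, ha'⟩ ⟨hb, hb'⟩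
    refine ⟨fun x => (ha _).comp (hb x), fun x => ?_⟩
    rw [mul_inv_rev]
    exact (hb' _).comp (ha' x)
  inv_mem' := by
    rintro a ⟨ha, ha'⟩
    exact ⟨ha', by simpa using ha⟩

/-- `Diff^ω(S¹)` as a type. -/
abbrev DiffAn : Type := ↥analyticDiffeos

/-- The value of an analytic diffeomorphism at a point. -/
abbrev DiffAn.app (g : DiffAn) (x : S1) : S1 := (g : Equiv.Perm S1) x

/-- The derivative `Df(x)` of `f : ℝ / ℤ → ℝ / ℤ`: the derivative at `h = 0` of the
representative in `(-1/2, 1/2]` of `f (x + h) - f x`. -/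
def circleDeriv (f : S1 → S1) (x : S1) : ℝ :=
  deriv (fun h : ℝ => ((AddCircle.equivIoc (1 : ℝ) (-(1 / 2)) (f (x + (h : S1)) - f x) :
    Ioc (-(1 / 2) : ℝ) (-(1 / 2) + 1)) : ℝ)) 0

/-- The derivative is computed by any continuous local lift. -/
theorem circleDeriv_eq {f : S1 → S1} {F : ℝ → ℝ} {t : ℝ} (hF : ContinuousAt F t)
    (hf : ∀ᶠ u : ℝ in 𝓝 t, f (u : S1) = (F u : S1)) :
    circleDeriv f (t : S1) = deriv F t := by
  have hadd : Tendsto (fun h : ℝ => t + h) (𝓝 0) (𝓝 t) := by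
    have : ContinuousAt (fun h : ℝ => t + h) 0 := by fun_prop
    simpa [ContinuousAt] using this
  have hlim : Tendsto (fun h : ℝ => F (t + h) - F t) (𝓝 0) (𝓝 0) := by
    simpa using (hF.tendsto.comp hadd).sub_const (F t)
  have hmem : ∀ᶠ h : ℝ in 𝓝 0, F (t + h) - F t ∈ Ioc (-(1 / 2) : ℝ) (-(1 / 2) + 1) :=
    hlim.eventually (Ioc_mem_nhds (by norm_num) (by norm_num))
  have key : (fun h : ℝ => ((AddCircle.equivIoc (1 : ℝ) (-(1 / 2))
      (f ((t : S1) + (h : S1)) - f (t : S1)) : Ioc (-(1 / 2) : ℝ) (-(1 / 2) + 1)) : ℝ))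
      =ᶠ[𝓝 0] fun h => F (t + h) - F t := by
    filter_upwards [hmem, hadd.eventually hf] with h h1 h2
    have h3 : f ((t : S1) + (h : S1)) - f (t : S1) = ((F (t + h) - F t : ℝ) : S1) := by
      rw [← AddCircle.coe_add, h2, hf.self_of_nhds, AddCircle.coe_sub]
    rw [h3]
    exact AddCircle.equivIoc_coe_of_mem h1
  rw [circleDeriv, key.deriv_eq, deriv_sub_const]
  simpa using deriv_comp_const_add F t 0

/-- `G` is expanding: at every point some element has `log |Dg(x)| > 0`. -/
def IsExpanding (G : Subgroup DiffAn) : Prop :=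
  ∀ x : S1, ∃ g ∈ G, 0 < Real.log |circleDeriv (DiffAn.app g) x|

/-- `φ` is a univalent (injective) holomorphic map from `V ⊆ ℂ / ℤ` to `ℂ / ℤ` that extends
the diffeomorphism `g`, i.e. agrees with it on the points of the circle in `V`. -/
def IsUnivalentExtension (g : DiffAn) (V : Set Cyl) (φ : Cyl → Cyl) : Prop :=
  (∀ z ∈ V, AnalyticAtMod (𝕜 := ℂ) φ z) ∧ InjOn φ V ∧
    ∀ y : S1, incl y ∈ V → φ (incl y) = incl (g.app y)

/-- `G` is non locally discrete in the analytic category at `x`: on some open neighbourhood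
`V ⊆ ℂ / ℤ` of `x`, a sequence of non-trivial elements of `G` has univalent holomorphic
extensions that converge uniformly to the identity. -/
def NonLocallyDiscreteAt (G : Subgroup DiffAn) (x : S1) : Prop :=
  ∃ V : Set Cyl, IsOpen V ∧ incl x ∈ V ∧
    ∃ (g : ℕ → DiffAn) (φ : ℕ → Cyl → Cyl),
      (∀ n, g n ∈ G ∧ g n ≠ 1) ∧
      (∀ n, IsUnivalentExtension (g n) V (φ n)) ∧
      TendstoUniformlyOn φ id atTop V

/-- Local discreteness in the analytic category at `x`. -/
def LocallyDiscreteAt (G : Subgroup DiffAn) (x : S1) : Prop :=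
  ¬ NonLocallyDiscreteAt G x

/-- Local discreteness in the analytic category: at some point of the circle. -/
def IsLocallyDiscrete (G : Subgroup DiffAn) : Prop :=
  ∃ x : S1, LocallyDiscreteAt G x

/-- The Cayley graph of `(G, S)`: vertices are the elements of `G`, edges the pairs
`{g, s g}` with `g ∈ G` and `s ∈ S` (loops discarded). -/
def cayleyGraph {G : Type*} [Group G] (S : Set G) : SimpleGraph G :=
  SimpleGraph.fromRel fun g h => ∃ s ∈ S, h = s * g

/-- A walk in a graph is geodesic if its length is the distance of its end points. -/
def IsGeodesic {V : Type*} {Γ : SimpleGraph V} {a b : V} (p : Γ.Walk a b) : Prop :=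
  p.length = Γ.dist a b

/-- Geodesic triangles of `Γ` are uniformly thin: for some `δ > 0` and all geodesics
`p = [a,b]`, `q = [b,c]`, `r = [a,c]`, each vertex of `r` is at distance less than `δ`
from a vertex of `p` or of `q`. -/
def HasThinTriangles {V : Type*} (Γ : SimpleGraph V) : Prop :=
  ∃ δ : ℝ, 0 < δ ∧ ∀ (a b c : V) (p : Γ.Walk a b) (q : Γ.Walk b c) (r : Γ.Walk a c),
    IsGeodesic p → IsGeodesic q → IsGeodesic r →
      ∀ v ∈ r.support, ∃ w, (w ∈ p.support ∨ w ∈ q.support) ∧ (Γ.dist v w : ℝ) < δ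

/-- A finitely generated group is Gromov hyperbolic if its Cayley graph with respect to every
finite symmetric generating set has uniformly thin geodesic triangles. -/
def IsGromovHyperbolic (G : Type*) [Group G] : Prop :=
  Group.FG G ∧ ∀ S : Set G, S.Finite → (∀ s ∈ S, s⁻¹ ∈ S) → Subgroup.closure S = ⊤ →
    HasThinTriangles (cayleyGraph S)

end CircleDyn

end

/-! Let x be a point where G is locally discrete, and give g ∈ G the height log|Dg(x)|. By expansion
and compactness, finitely many elements of G expand every point by a factor between some l > 1 and
M. Multiplying v on the left by the one chosen at v(x) defines a self-map T of the Cayley graph, of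
bounded displacement, that raises the height by at least log l and at most log M.

The heart of the matter is that orbits of T merge. Let v = f u be at distance at most K from u, and
let T^m u = A u and T^n v = A' v have climbed far enough and reach heights differing by at most log
M. Bounded distortion makes A⁻¹ and f⁻¹A'⁻¹ holomorphic and almost affine on balls of a fixed radius
around Au(x) and A'v(x) (`exists_good_itinerary`, `exists_good_mul_of_finite`). They take the common
value u(x) there, with comparable derivatives. Hence the transition A'fA⁻¹, which carries T^m u to
T^n v, has a holomorphic lift on a ball of uniform size, with a uniform Lipschitz constant.
Infinitely many such transitions would, by an Arzelà–Ascoli argument, contain two whose quotient is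
non-trivial and arbitrarily close to the identity on a fixed complex ball centred on the orbit of x;
conjugating back to x contradicts discreteness (`finite_transitions`). So the orbits end up at a
distance bounded independently of K, only the waiting time depending on K.

Hyperbolicity is then combinatorial. Join a to b by following both trajectories up to their merging
height. Merging heights satisfy the ultrametric inequality up to an additive constant, so these
coarse paths form thin triangles (`hasThinTriangles_of_flow`). A "guessing geodesics" argument shows
that such paths stay uniformly close to geodesics and conversely (`exists_near_geodesic`,
`exists_geodesic_near`), so geodesic triangles are thin too. -/

namespace CircleDyn

/-! ### Guessing geodesics: thin families of coarse paths force thin triangles. -/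

section Hyperbolicity

variable {V : Type*} {Γ : SimpleGraph V}

/-- A family of coarsely connected sets `η a b`, joining `a` to `b`, that form thin triangles. -/
structure CoarsePaths (Γ : SimpleGraph V) (η : V → V → Set V) (D : ℕ) : Prop where
  left_mem : ∀ a b, a ∈ η a b
  right_mem : ∀ a b, b ∈ η a b
  jump : ∀ a b (P : Set V), a ∈ P → b ∉ P →
    ∃ w ∈ η a b, ∃ w' ∈ η a b, w ∈ P ∧ w' ∉ P ∧ Γ.dist w w' ≤ D
  thin : ∀ a b c, ∀ v ∈ η a c, ∃ w, (w ∈ η a b ∨ w ∈ η b c) ∧ Γ.dist v w ≤ D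
  small : ∀ a b, Γ.dist a b ≤ 1 → ∀ w ∈ η a b, Γ.dist w a ≤ D

/-- `f` restricted to `[i, j]` is a geodesic sequence of vertices. -/
def IsGeodesicSeq (Γ : SimpleGraph V) (f : ℕ → V) (i j : ℕ) : Prop :=
  ∀ a b, i ≤ a → a ≤ b → b ≤ j → Γ.dist (f a) (f b) = b - a

theorem IsGeodesicSeq.mono {f : ℕ → V} {i j i' j' : ℕ} (h : IsGeodesicSeq Γ f i j)
    (hi : i ≤ i') (hj : j' ≤ j) : IsGeodesicSeq Γ f i' j' :=
  fun a b h1 h2 h3 => h a b (hi.trans h1) h2 (h3.trans hj)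

theorem dist_getVert_le {a b : V} (hc : Γ.Connected) (p : Γ.Walk a b) (i j : ℕ) (hij : i ≤ j)
    (hj : j ≤ p.length) : Γ.dist (p.getVert i) (p.getVert j) ≤ j - i := by
  induction j, hij using Nat.le_induction with
  | base => simp
  | succ k hk ih =>
    have h1 := ih (by omega)
    have h2 : Γ.dist (p.getVert k) (p.getVert (k + 1)) = 1 :=
      SimpleGraph.dist_eq_one_iff_adj.mpr (p.adj_getVert_succ (by omega))
    have h3 := hc.dist_triangle (u := p.getVert i) (v := p.getVert k) (w := p.getVert (k + 1))
    omega

theorem IsGeodesic.isGeodesicSeq {a b : V} (hc : Γ.Connected) {p : Γ.Walk a b}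
    (hp : IsGeodesic p) : IsGeodesicSeq Γ p.getVert 0 p.length := by
  intro i j _ hij hj
  have h1 := dist_getVert_le hc p 0 i (by omega) (by omega)
  have h2 := dist_getVert_le hc p i j hij hj
  have h3 := dist_getVert_le hc p j p.length hj le_rfl
  rw [SimpleGraph.Walk.getVert_zero] at h1
  rw [SimpleGraph.Walk.getVert_length] at h3
  have h4 := hc.dist_triangle (u := a) (v := p.getVert i) (w := b)
  have h5 := hc.dist_triangle (u := p.getVert i) (v := p.getVert j) (w := b)
  have h6 : p.length = Γ.dist a b := hp
  omega

theorem exists_mul_lt_two_pow (A : ℕ) : ∃ n₀, ∀ n ≥ n₀, A * (n + 4) < 2 ^ n := by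
  refine ⟨16 * A, fun n hn => ?_⟩
  have h1 : n / 2 < 2 ^ (n / 2) := Nat.lt_two_pow_self
  have h2 : n - n / 2 < 2 ^ (n - n / 2) := Nat.lt_two_pow_self
  have h3 : 2 ^ (n / 2) * 2 ^ (n - n / 2) = 2 ^ n := by rw [← pow_add]; congr 1; omega
  have h4 : (n / 2 + 1) * (n / 2 + 1) ≤ 2 ^ n := by
    rw [← h3]; exact Nat.mul_le_mul (by omega) (by omega)
  have h5 : n + 1 ≤ 2 * (n / 2 + 1) := by omega
  have h6 : (n + 1) * (n + 1) ≤ 4 * 2 ^ n := by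
    calc (n + 1) * (n + 1) ≤ (2 * (n / 2 + 1)) * (2 * (n / 2 + 1)) := Nat.mul_le_mul h5 h5
      _ = 4 * ((n / 2 + 1) * (n / 2 + 1)) := by ring
      _ ≤ _ := Nat.mul_le_mul_left _ h4
  nlinarith

namespace CoarsePaths

variable {η : V → V → Set V} {D : ℕ}

/-- Bisect the geodesic: each halving costs one use of thinness, hence D, and after k halvings the
endpoints are at distance at most 1. The bound is thus logarithmic in the length; it is bootstrapped
to a uniform one in `exists_near_geodesic`. -/
theorem exists_dist_le_log (hη : CoarsePaths Γ η D) (hc : Γ.Connected) (k : ℕ) (f : ℕ → V)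
    (i j : ℕ) (hij : i ≤ j) (hf : IsGeodesicSeq Γ f i j) (hk : j - i ≤ 2 ^ k) (z : V)
    (hz : z ∈ η (f i) (f j)) : ∃ m, i ≤ m ∧ m ≤ j ∧ Γ.dist z (f m) ≤ D * (k + 1) := by
  induction k generalizing i j z with
  | zero =>
    refine ⟨i, le_rfl, hij, ?_⟩
    have := hη.small (f i) (f j) (by rw [hf i j le_rfl hij le_rfl]; simpa using hk) z hz
    simpa using this
  | succ k ih =>
    have h2 : 2 ^ (k + 1) = 2 * 2 ^ k := by ring
    obtain ⟨w, hw, hzw⟩ := hη.thin (f i) (f (i + (j - i) / 2)) (f j) z hz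
    have : ∃ m, i ≤ m ∧ m ≤ j ∧ Γ.dist w (f m) ≤ D * (k + 1) := by
      rcases hw with hw | hw
      · obtain ⟨m, h3, h4, h5⟩ := ih i (i + (j - i) / 2) (by omega)
          (hf.mono le_rfl (by omega)) (by omega) w hw
        exact ⟨m, h3, by omega, h5⟩
      · obtain ⟨m, h3, h4, h5⟩ := ih (i + (j - i) / 2) j (by omega)
          (hf.mono (by omega) le_rfl) (by omega) w hw
        exact ⟨m, by omega, h4, h5⟩
    obtain ⟨m, h3, h4, h5⟩ := this
    refine ⟨m, h3, h4, ?_⟩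
    have h6 := hc.dist_triangle (u := z) (v := w) (w := f m)
    have h7 : D * (k + 1 + 1) = D * (k + 1) + D := by ring
    omega

/-- Coarse paths stay uniformly close to geodesics. -/
theorem exists_near_geodesic (hη : CoarsePaths Γ η D) (hc : Γ.Connected) :
    ∃ H : ℕ, ∀ (f : ℕ → V) (i j : ℕ), i ≤ j → IsGeodesicSeq Γ f i j → ∀ z ∈ η (f i) (f j),
      ∃ m, i ≤ m ∧ m ≤ j ∧ Γ.dist z (f m) ≤ H := by
  -- Above the threshold H, a deviation R exceeds the logarithmic bound for a geodesic of length 6R,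
  -- with 2D to spare; this is where the exponential beats 6D(n + 4).
  obtain ⟨n₀, hn₀⟩ := exists_mul_lt_two_pow (6 * D)
  obtain ⟨H, hH⟩ : ∃ H, H = 2 ^ n₀ + 3 * D := ⟨_, rfl⟩
  have hlog : ∀ R > H, ∃ k, 6 * R ≤ 2 ^ k ∧ 2 * D + D * (k + 1) < R := by
    intro R hR
    refine ⟨Nat.log 2 (6 * R) + 1, (Nat.lt_pow_succ_log_self (by norm_num) _).le, ?_⟩
    have h1 : 2 ^ Nat.log 2 (6 * R) ≤ 6 * R := Nat.pow_log_le_self _ (by omega)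
    have h2 : n₀ ≤ Nat.log 2 (6 * R) := by
      apply Nat.le_log_of_pow_le (by norm_num); omega
    have h3 := hn₀ _ h2
    nlinarith
  refine ⟨H, ?_⟩
  suffices h : ∀ (n : ℕ) (f : ℕ → V) (i j : ℕ), j - i = n → i ≤ j → IsGeodesicSeq Γ f i j →
      ∀ z ∈ η (f i) (f j), ∃ m, i ≤ m ∧ m ≤ j ∧ Γ.dist z (f m) ≤ H from
    fun f i j => h _ f i j rfl
  intro n
  induction n using Nat.strong_induction_on with
  | _ n ih =>
    intro f i j hn hij hf z hz
    by_contra! hcon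
    obtain ⟨m₀, hm₀, hmin⟩ := (Finset.Icc i j).exists_min_image (fun m => Γ.dist z (f m))
      ⟨i, by simp [hij]⟩
    rw [Finset.mem_Icc] at hm₀
    obtain ⟨R, hR⟩ : ∃ R, R = Γ.dist z (f m₀) := ⟨_, rfl⟩
    have hRH : H < R := hR ▸ hcon m₀ hm₀.1 hm₀.2
    have hmin' : ∀ m, i ≤ m → m ≤ j → R ≤ Γ.dist z (f m) := fun m h1 h2 =>
      hR ▸ hmin m (by simp [h1, h2])
    obtain ⟨k, hk, hk'⟩ := hlog R hRH
    -- The window [x, y] of radius 3R around the index m₀ of a point nearest to z. The coarse path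
    -- over it deviates by less than R - 2D, while by induction the paths over the rest lie within H
    -- < R of points at distance at least 3R from f m₀. So none of them comes within 2D of z,
    -- although two uses of thinness put z that close to one.
    set x := max i (m₀ - 3 * R) with hx
    set y := min j (m₀ + 3 * R) with hy
    have hfar : ∀ i' j' w, i ≤ i' → i' ≤ j' → j' ≤ j → j' - i' < n → w ∈ η (f i') (f j') →
        Γ.dist z w ≤ 2 * D → (j' + 3 * R ≤ m₀ ∨ m₀ + 3 * R ≤ i') → False := by
      intro i' j' w h1 h2 h3 h4 h5 h6 h7
      obtain ⟨m, h8, h9, h10⟩ := ih _ h4 f i' j' rfl h2 (hf.mono h1 h3) w h5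
      have h11 := hc.dist_triangle (u := z) (v := w) (w := f m)
      rcases h7 with h7 | h7
      · have h12 := hc.dist_triangle (u := f m) (v := z) (w := f m₀)
        rw [hf m m₀ (by omega) (by omega) (by omega), SimpleGraph.dist_comm (u := f m)] at h12
        omega
      · have h12 := hc.dist_triangle (u := f m₀) (v := z) (w := f m)
        rw [hf m₀ m (by omega) (by omega) (by omega), SimpleGraph.dist_comm (u := f m₀)] at h12
        omega
    have hmid : ∀ w ∈ η (f x) (f y), Γ.dist z w ≤ 2 * D → False := by
      intro w hw hzw
      obtain ⟨m, h1, h2, h3⟩ := hη.exists_dist_le_log hc k f x y (by omega)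
        (hf.mono (by omega) (by omega)) (by omega) w hw
      have h4 := hc.dist_triangle (u := z) (v := w) (w := f m)
      have h5 := hmin' m (by omega) (by omega)
      omega
    have hend : ∀ w, Γ.dist z w ≤ D → w ∉ η (f i) (f x) ∧ w ∉ η (f x) (f j) := by
      intro w hzw
      constructor
      · intro hw
        by_cases hxi : x = i
        · rw [hxi] at hw
          have h1 := hη.small (f i) (f i) (by simp) w hw
          have h2 := hc.dist_triangle (u := z) (v := w) (w := f i)
          have h3 := hmin' i le_rfl hij
          omega
        · exact hfar i x w le_rfl (by omega) (by omega) (by omega) hw (by omega) (by omega)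
      · intro hw
        obtain ⟨w', hw', hd⟩ := hη.thin (f x) (f y) (f j) w hw
        have h1 := hc.dist_triangle (u := z) (v := w) (w := w')
        rcases hw' with hw' | hw'
        · exact hmid w' hw' (by omega)
        · by_cases hyj : y = j
          · rw [hyj] at hw'
            have h4 := hη.small (f j) (f j) (by simp) w' hw'
            have h2 := hc.dist_triangle (u := z) (v := w') (w := f j)
            have h3 := hmin' j hij le_rfl
            clear hx hy
            linarith [Nat.zero_le (2 ^ n₀)]
          · exact hfar y j w' (by omega) (by omega) le_rfl (by omega) hw' (by omega) (by omega)
    obtain ⟨w, hw, hd⟩ := hη.thin (f i) (f x) (f j) z hz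
    rcases hw with hw | hw
    · exact (hend w hd).1 hw
    · exact (hend w hd).2 hw

/-- Geodesics stay uniformly close to coarse paths. -/
theorem exists_geodesic_near (hη : CoarsePaths Γ η D) (hc : Γ.Connected) :
    ∃ H : ℕ, ∀ (f : ℕ → V) (i j : ℕ), IsGeodesicSeq Γ f i j → ∀ m, i ≤ m → m ≤ j →
      ∃ w ∈ η (f i) (f j), Γ.dist (f m) w ≤ H := by
  obtain ⟨H, hH⟩ := hη.exists_near_geodesic hc
  refine ⟨3 * H + D, fun f i j hf m him hmj => ?_⟩
  by_cases hj : ∃ m', i ≤ m' ∧ m' ≤ m ∧ Γ.dist (f j) (f m') ≤ H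
  · obtain ⟨m', h1, h2, h3⟩ := hj
    rw [SimpleGraph.dist_comm, hf m' j h1 (by omega) le_rfl] at h3
    exact ⟨f j, hη.right_mem _ _, by rw [hf m j him hmj le_rfl]; omega⟩
  -- The coarse path must leave the H-neighbourhood of the initial segment up to m. At that jump it
  -- is near some f m₁ with m₁ ≤ m and near some f m₂ with m < m₂, and m₂ - m₁ ≤ 2H + D.
  · obtain ⟨w, hw, w', hw', ⟨m₁, h1, h2, h3⟩, hP, hd⟩ := hη.jump (f i) (f j)
      {v | ∃ m', i ≤ m' ∧ m' ≤ m ∧ Γ.dist v (f m') ≤ H} ⟨i, le_rfl, him, by simp⟩ hj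
    obtain ⟨m₂, h4, h5, h6⟩ := hH f i j (by omega) hf w' hw'
    have h7 : m < m₂ := by
      by_contra! h
      exact hP ⟨m₂, h4, h, h6⟩
    have h8 := hc.dist_triangle (u := f m₁) (v := w) (w := f m₂)
    have h9 := hc.dist_triangle (u := w) (v := w') (w := f m₂)
    rw [hf m₁ m₂ h1 (by omega) h5, SimpleGraph.dist_comm (u := f m₁)] at h8
    have h10 := hc.dist_triangle (u := f m) (v := f m₁) (w := w)
    rw [SimpleGraph.dist_comm (u := f m) (v := f m₁), hf m₁ m h1 h2 hmj,
      SimpleGraph.dist_comm (u := f m₁)] at h10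
    exact ⟨w, hw, by omega⟩

theorem hasThinTriangles (hη : CoarsePaths Γ η D) (hc : Γ.Connected) : HasThinTriangles Γ := by
  obtain ⟨H, hH⟩ := hη.exists_near_geodesic hc
  obtain ⟨K, hK⟩ := hη.exists_geodesic_near hc
  have key : ∀ {a b : V} (p : Γ.Walk a b), IsGeodesic p → ∀ z ∈ η a b,
      ∃ w ∈ p.support, Γ.dist z w ≤ H := by
    intro a b p hp z hz
    obtain ⟨m, -, -, h⟩ := hH p.getVert 0 p.length (by omega) (hp.isGeodesicSeq hc) z
      (by simpa using hz)
    exact ⟨_, p.getVert_mem_support m, h⟩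
  refine ⟨(K + D + H + 1 : ℕ), by positivity, fun a b c p q r hp hq hr v hv => ?_⟩
  obtain ⟨m, rfl, hm⟩ := SimpleGraph.Walk.mem_support_iff_exists_getVert.mp hv
  obtain ⟨w, hw, hvw⟩ := hK r.getVert 0 r.length (hr.isGeodesicSeq hc) m (by omega) hm
  simp only [SimpleGraph.Walk.getVert_zero, SimpleGraph.Walk.getVert_length] at hw
  obtain ⟨w', hw', hd⟩ := hη.thin a b c w hw
  have h1 := hc.dist_triangle (u := r.getVert m) (v := w) (w := w')
  rcases hw' with hw' | hw'
  · obtain ⟨u, hu, hd'⟩ := key p hp w' hw'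
    have h2 := hc.dist_triangle (u := r.getVert m) (v := w') (w := u)
    exact ⟨u, Or.inl hu, by exact_mod_cast (by omega : Γ.dist (r.getVert m) u < K + D + H + 1)⟩
  · obtain ⟨u, hu, hd'⟩ := key q hq w' hw'
    have h2 := hc.dist_triangle (u := r.getVert m) (v := w') (w := u)
    exact ⟨u, Or.inr hu, by exact_mod_cast (by omega : Γ.dist (r.getVert m) u < K + D + H + 1)⟩

end CoarsePaths

end Hyperbolicity

/-! ### Thin triangles from a flow with merging trajectories. -/

section Flow

variable {V : Type*} {Γ : SimpleGraph V}

theorem exists_int_switch {P : ℤ → Prop} {s t : ℤ} (hst : s ≤ t) (hs : P s) (ht : ¬ P t) :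
    ∃ r, s ≤ r ∧ r < t ∧ P r ∧ ¬ P (r + 1) := by
  by_contra! h
  have : ∀ r, s ≤ r → r ≤ t → P r := by
    intro r hr
    induction r, hr using Int.leInduction with
    | base => exact fun _ => hs
    | succ k hk ih => exact fun hkt => h k hk (by omega) (ih (by omega))
  exact ht (this t hst le_rfl)

theorem dist_flow_le (hc : Γ.Connected) {U : ℤ → V → V} {c : ℕ}
    (hstep : ∀ t v, Γ.dist (U t v) (U (t + 1) v) ≤ c) (v : V) {s t : ℤ} (hst : s ≤ t) {k : ℕ}
    (hk : t - s ≤ k) : Γ.dist (U s v) (U t v) ≤ c * k := by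
  induction k generalizing t with
  | zero =>
    obtain rfl : s = t := by simp at hk; omega
    simp
  | succ k ih =>
    rcases hst.eq_or_lt with rfl | hlt
    · simp
    · have h1 := ih (t := t - 1) (by omega) (by push_cast at hk; omega)
      have h2 := hstep (t - 1) v
      rw [sub_add_cancel] at h2
      have h3 := hc.dist_triangle (u := U s v) (v := U (t - 1) v) (w := U t v)
      have h4 : c * (k + 1) = c * k + c := by ring
      omega

/-- A connected graph has thin triangles if it carries a flow `U`, parametrized by a height,
such that any two trajectories end up at a uniformly bounded distance, after a time controlled
by the distance of their starting points. -/
theorem hasThinTriangles_of_flow (hc : Γ.Connected) (U : ℤ → V → V) (ℓ : V → ℤ) (c D₀ : ℕ)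
    (hstart : ∀ t v, t ≤ ℓ v → U t v = v)
    (hstep : ∀ t v, Γ.dist (U t v) (U (t + 1) v) ≤ c)
    (hcomp : ∀ s t v, s ≤ t → U t (U s v) = U t v)
    (hheight : ∀ s v, ℓ (U s v) ≤ max (ℓ v) (s + c))
    (hadj : ∀ u v, Γ.Adj u v → |ℓ u - ℓ v| ≤ c)
    (hmerge : ∀ K : ℕ, ∃ N : ℕ, ∀ u v, Γ.dist u v ≤ K → ∀ t, ℓ u + N ≤ t → ℓ v + N ≤ t →
      Γ.dist (U t u) (U t v) ≤ D₀) :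
    HasThinTriangles Γ := by
  -- The merging height μ a b: the least height above both points from which the two trajectories
  -- stay within D₀. The coarse path from a to b consists of both trajectories up to μ a b.
  have hμ : ∀ a b, ∃ m : ℤ, (ℓ a ≤ m ∧ ℓ b ≤ m ∧ ∀ t ≥ m, Γ.dist (U t a) (U t b) ≤ D₀) ∧
      ∀ m' : ℤ, (ℓ a ≤ m' ∧ ℓ b ≤ m' ∧ ∀ t ≥ m', Γ.dist (U t a) (U t b) ≤ D₀) → m ≤ m' := by
    intro a b
    refine Int.exists_least_of_bdd ⟨ℓ a, fun z hz => hz.1⟩ ?_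
    obtain ⟨N, hN⟩ := hmerge (Γ.dist a b)
    refine ⟨max (ℓ a) (ℓ b) + N, by omega, by omega, fun t ht => ?_⟩
    exact hN a b le_rfl t (by omega) (by omega)
  choose μ hμ hμmin using hμ
  obtain ⟨N₁, hN₁⟩ := hmerge 1
  obtain ⟨N₂, hN₂⟩ := hmerge (2 * D₀)
  refine CoarsePaths.hasThinTriangles (D := c + D₀ + c * (c + N₂) + c * (c + N₁) + 1)
    (η := fun a b => {w | ∃ t ≤ μ a b, w = U t a ∨ w = U t b}) ?_ hc
  refine ⟨?_, ?_, ?_, ?_, ?_⟩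
  · exact fun a b => ⟨ℓ a, (hμ a b).1, Or.inl (hstart _ _ le_rfl).symm⟩
  · exact fun a b => ⟨ℓ b, (hμ a b).2.1, Or.inr (hstart _ _ le_rfl).symm⟩
  · intro a b P ha hb
    by_cases h1 : U (μ a b) a ∈ P
    · by_cases h2 : U (μ a b) b ∈ P
      · obtain ⟨r, h3, h4, h5, h6⟩ := exists_int_switch (P := fun t => U t b ∉ P) (hμ a b).2.1
          (by rwa [hstart _ _ le_rfl]) (by simpa using h2)
        refine ⟨U (r + 1) b, ⟨r + 1, by omega, Or.inr rfl⟩, U r b, ⟨r, by omega, Or.inr rfl⟩,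
          by simpa using h6, h5, ?_⟩
        have := hstep r b
        rw [SimpleGraph.dist_comm]; omega
      · exact ⟨_, ⟨_, le_rfl, Or.inl rfl⟩, _, ⟨_, le_rfl, Or.inr rfl⟩, h1, h2,
          by have := (hμ a b).2.2 _ le_rfl; omega⟩
    · obtain ⟨r, h3, h4, h5, h6⟩ := exists_int_switch (P := fun t => U t a ∈ P) (hμ a b).1
        (by rwa [hstart _ _ le_rfl]) h1
      exact ⟨U r a, ⟨r, by omega, Or.inl rfl⟩, U (r + 1) a, ⟨r + 1, by omega, Or.inl rfl⟩, h5, h6,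
        by have := hstep r a; omega⟩
  -- Below μ a b the trajectory of a belongs to the first side; below μ b e but above μ a b it has
  -- merged with that of b; otherwise only c + N₂ units of height remain, which the flow crosses in
  -- bounded distance.
  · have key : ∀ a b e : V, ∀ t ≤ max (μ a b) (μ b e) + c + N₂,
        ∃ w, ((∃ s ≤ μ a b, w = U s a ∨ w = U s b) ∨ (∃ s ≤ μ b e, w = U s b ∨ w = U s e)) ∧
          Γ.dist (U t a) w ≤ D₀ + c * (c + N₂) := by
      intro a b e t ht
      rcases le_or_gt t (μ a b) with h1 | h1
      · exact ⟨U t a, Or.inl ⟨t, h1, Or.inl rfl⟩, by simp⟩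
      rcases le_or_gt t (μ b e) with h2 | h2
      · exact ⟨U t b, Or.inr ⟨t, h2, Or.inl rfl⟩, by have := (hμ a b).2.2 t h1.le; omega⟩
      rcases le_total (μ b e) (μ a b) with h3 | h3
      · refine ⟨U (μ a b) a, Or.inl ⟨_, le_rfl, Or.inl rfl⟩, ?_⟩
        have := dist_flow_le hc hstep a h1.le (k := c + N₂) (by push_cast; omega)
        rw [SimpleGraph.dist_comm]; omega
      · refine ⟨U (μ b e) b, Or.inr ⟨_, le_rfl, Or.inl rfl⟩, ?_⟩
        have h4 := dist_flow_le hc hstep a h2.le (k := c + N₂) (by push_cast; omega)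
        rw [SimpleGraph.dist_comm] at h4
        have h5 := (hμ a b).2.2 _ h3
        have h6 := hc.dist_triangle (u := U t a) (v := U (μ b e) a) (w := U (μ b e) b)
        omega
    have hsymm : ∀ a b, μ b a = μ a b := by
      have : ∀ a b, μ b a ≤ μ a b := fun a b => hμmin b a _
        ⟨(hμ a b).2.1, (hμ a b).1, fun t ht => by
          rw [SimpleGraph.dist_comm]; exact (hμ a b).2.2 t ht⟩
      exact fun a b => le_antisymm (this a b) (this b a)
    -- At height T both a and e have merged with b, so they are within 2D₀ of each other, at heights
    -- at most T + c; merging for K = 2D₀ then takes N₂ more.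
    have hultra : ∀ a b e, μ a e ≤ max (μ a b) (μ b e) + c + N₂ := by
      intro a b e
      obtain ⟨T, hT⟩ : ∃ T, T = max (μ a b) (μ b e) := ⟨_, rfl⟩
      rw [← hT]
      have h1 := (hμ a b).2.2 T (by omega)
      have h2 := (hμ b e).2.2 T (by omega)
      have h3 := hc.dist_triangle (u := U T a) (v := U T b) (w := U T e)
      have h4 := hheight T a
      have h5 := hheight T e
      have h6 := (hμ a b).1
      have h7 := (hμ b e).2.1
      refine hμmin a e _ ⟨by omega, by omega, fun t ht => ?_⟩
      have := hN₂ (U T a) (U T e) (by omega) t (by omega) (by omega)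
      rwa [hcomp _ _ _ (by omega), hcomp _ _ _ (by omega)] at this
    rintro a b e v ⟨t, ht, rfl | rfl⟩
    · obtain ⟨w, hw, hd⟩ := key a b e t (ht.trans (hultra a b e))
      exact ⟨w, hw, by omega⟩
    · obtain ⟨w, hw, hd⟩ := key e b a t (by
        rw [hsymm b e, hsymm a b, max_comm]; exact ht.trans (hultra a b e))
      rw [hsymm b e, hsymm a b] at hw
      refine ⟨w, ?_, by omega⟩
      rcases hw with ⟨s, hs, h⟩ | ⟨s, hs, h⟩
      · exact Or.inr ⟨s, hs, h.symm⟩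
      · exact Or.inl ⟨s, hs, h.symm⟩
  · intro a b hab w ⟨t, ht, hw⟩
    have h1 : |ℓ a - ℓ b| ≤ c := by
      rcases Nat.le_one_iff_eq_zero_or_eq_one.mp hab with h | h
      · rw [hc.dist_eq_zero_iff.mp h]; simp
      · exact hadj a b (SimpleGraph.dist_eq_one_iff_adj.mp h)
    rw [abs_le] at h1
    have h2 : μ a b ≤ max (ℓ a) (ℓ b) + N₁ :=
      hμmin a b _ ⟨by omega, by omega, fun t ht => hN₁ a b hab t (by omega) (by omega)⟩
    have h3 : ∀ v, ℓ v + c ≥ max (ℓ a) (ℓ b) → Γ.dist (U t v) v ≤ c * (c + N₁) := by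
      intro v hv
      rcases le_total t (ℓ v) with h | h
      · rw [hstart t v h]; simp
      · have := dist_flow_le hc hstep v h (k := c + N₁) (by push_cast; omega)
        rwa [hstart (ℓ v) v le_rfl, SimpleGraph.dist_comm] at this
    rcases hw with rfl | rfl
    · have := h3 a (by omega); omega
    · have h4 := h3 b (by omega)
      have h5 := hc.dist_triangle (u := U t b) (v := b) (w := a)
      rw [SimpleGraph.dist_comm (u := b)] at h5
      omega

end Flow

/-! ### Holomorphic lifts of analytic circle diffeomorphisms. -/

section Lifts

/-- A real-analytic function of a real variable extends holomorphically to a complex ball. -/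
theorem exists_complexification {F : ℝ → ℝ} {t : ℝ} (hF : AnalyticAt ℝ F t) :
    ∃ ρ > 0, ∃ H : ℂ → ℂ, DifferentiableOn ℂ H (Metric.ball (t : ℂ) ρ) ∧
      ∀ u : ℝ, (u : ℂ) ∈ Metric.ball (t : ℂ) ρ → H u = (F u : ℂ) := by
  obtain ⟨p, r, hp⟩ := hF
  obtain ⟨ρ, hρ0, hρ⟩ := ENNReal.lt_iff_exists_nnreal_btwn.mp hp.r_pos
  have hρ0' : 0 < ρ := by exact_mod_cast hρ0
  obtain ⟨C, hC, hbound⟩ := p.norm_mul_pow_le_of_lt_radius (hρ.trans_le hp.r_le)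
  set q : FormalMultilinearSeries ℂ ℂ ℂ :=
    FormalMultilinearSeries.ofScalars ℂ (fun n => ((p.coeff n : ℝ) : ℂ)) with hq
  have hqr : (ρ : ENNReal) ≤ q.radius := by
    refine q.le_radius_of_bound C fun n => ?_
    rw [hq, FormalMultilinearSeries.ofScalars_norm, Complex.norm_real,
      ← FormalMultilinearSeries.norm_apply_eq_norm_coef]
    exact hbound n
  have hqs := q.hasFPowerSeriesOnBall (hρ0.trans_le hqr)
  refine ⟨ρ, by exact_mod_cast hρ0', fun z => q.sum (z - t), ?_, fun u hu => ?_⟩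
  · refine (hqs.differentiableOn (𝕜 := ℂ)).comp (by fun_prop) fun z hz => ?_
    rw [Metric.mem_ball, dist_eq_norm] at hz
    have : (‖z - t‖₊ : ENNReal) < ρ := by exact_mod_cast hz
    simpa [enorm_eq_nnnorm] using this.trans_le hqr
  · have hu' : (u : ℂ) - t = ((u - t : ℝ) : ℂ) := by push_cast; ring
    have hmem : u ∈ Metric.eball t r := by
      rw [Metric.mem_ball, dist_eq_norm, hu', Complex.norm_real, ← dist_eq_norm] at hu
      rw [Metric.mem_eball, edist_dist]
      exact ((ENNReal.ofReal_lt_coe_iff (by positivity)).mpr hu).trans hρ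
    have h1 := hp.hasSum_sub hmem
    simp only [hu', FormalMultilinearSeries.sum, hq, FormalMultilinearSeries.ofScalars_apply_eq]
    rw [← h1.tsum_eq, Complex.ofReal_tsum]
    refine tsum_congr fun n => ?_
    rw [FormalMultilinearSeries.apply_eq_pow_smul_coeff]
    simp [mul_comm]

/-- `F` is holomorphic on `U ⊆ ℂ` and on the real points of `U` it is a real lift of `f`. -/
def IsLift (f : S1 → S1) (U : Set ℂ) (F : ℂ → ℂ) : Prop :=
  DifferentiableOn ℂ F U ∧ ∀ u : ℝ, (u : ℂ) ∈ U → ∃ v : ℝ, F u = v ∧ f (u : S1) = (v : S1)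

theorem IsLift.mono {f : S1 → S1} {U V : Set ℂ} {F : ℂ → ℂ} (h : IsLift f U F) (hVU : V ⊆ U) :
    IsLift f V F :=
  ⟨h.1.mono hVU, fun u hu => h.2 u (hVU hu)⟩

theorem IsLift.comp {f h : S1 → S1} {U V : Set ℂ} {F H : ℂ → ℂ} (hH : IsLift h V H)
    (hF : IsLift f U F) (hm : MapsTo F U V) : IsLift (fun y => h (f y)) U (fun z => H (F z)) := by
  refine ⟨hH.1.comp hF.1 hm, fun u hu => ?_⟩
  obtain ⟨v, hv, hfv⟩ := hF.2 u hu
  obtain ⟨w, hw, hhw⟩ := hH.2 v (hv ▸ hm hu)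
  exact ⟨w, by simp only [hv, hw], by simp only [hfv, hhw]⟩

theorem coe_int_S1 (n : ℤ) : ((n : ℝ) : S1) = 0 := by
  rw [AddCircle.coe_eq_zero_iff]
  exact ⟨n, by simp⟩

theorem coe_add_int (t : ℝ) (n : ℤ) : ((t + n : ℝ) : S1) = (t : S1) := by
  rw [AddCircle.coe_add, coe_int_S1, add_zero]

theorem exists_int_of_coe_eq {s t : ℝ} (h : (s : S1) = (t : S1)) : ∃ n : ℤ, s = t + n := by
  rw [QuotientAddGroup.eq] at h
  obtain ⟨n, hn⟩ := h
  refine ⟨-n, ?_⟩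
  simp at hn
  push_cast
  linarith

theorem IsLift.add_int {f : S1 → S1} {U : Set ℂ} {F : ℂ → ℂ} (h : IsLift f U F) (n : ℤ) :
    IsLift f U (fun z => F z + n) := by
  refine ⟨h.1.add_const _, fun u hu => ?_⟩
  obtain ⟨v, hv, hfv⟩ := h.2 u hu
  exact ⟨v + n, by simp [hv], by rw [hfv, coe_add_int]⟩

theorem IsLift.translate {f : S1 → S1} {t ρ : ℝ} {F : ℂ → ℂ}
    (h : IsLift f (Metric.ball (t : ℂ) ρ) F) (n : ℤ) :
    IsLift f (Metric.ball ((t + n : ℝ) : ℂ) ρ) (fun z => F (z - n)) := by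
  have hm : MapsTo (fun z : ℂ => z - n) (Metric.ball ((t + n : ℝ) : ℂ) ρ)
      (Metric.ball (t : ℂ) ρ) := by
    intro z hz
    rw [Metric.mem_ball, dist_eq_norm] at hz ⊢
    convert hz using 2
    push_cast; ring
  refine ⟨h.1.comp (by fun_prop) hm, fun u hu => ?_⟩
  obtain ⟨v, hv, hfv⟩ := h.2 (u - n) (by simpa using hm hu)
  refine ⟨v, by rw [← hv]; push_cast; rfl, ?_⟩
  rw [← hfv]
  congr 1
  have := coe_add_int (u - n) n
  rw [← this]; simp

/-- The lift is real on real points, so its complex derivative there has zero imaginary part and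
coincides with the derivative of the real lift. -/
theorem IsLift.hasDerivAt {f : S1 → S1} {U : Set ℂ} {F : ℂ → ℂ} (h : IsLift f U F)
    (hU : IsOpen U) {t : ℝ} (ht : (t : ℂ) ∈ U) :
    HasDerivAt F (circleDeriv f (t : S1) : ℂ) t := by
  have hd : HasDerivAt F (deriv F t) t := (h.1.differentiableAt (hU.mem_nhds ht)).hasDerivAt
  have hev : ∀ᶠ u : ℝ in 𝓝 t, (u : ℂ) ∈ U :=
    Complex.continuous_ofReal.continuousAt.eventually (hU.mem_nhds ht)
  have hre := hd.real_of_complex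
  have him := (hd.const_mul (-Complex.I)).real_of_complex
  have h0 : (fun u : ℝ => (-Complex.I * F u).re) =ᶠ[𝓝 t] fun _ => 0 := by
    filter_upwards [hev] with u hu
    obtain ⟨v, hv, -⟩ := h.2 u hu
    simp [hv]
  have him0 : (deriv F t).im = 0 := by
    have := him.deriv
    rw [h0.deriv_eq] at this
    simpa using this.symm
  have hlift : ∀ᶠ u : ℝ in 𝓝 t, f (u : S1) = (((F u).re : ℝ) : S1) := by
    filter_upwards [hev] with u hu
    obtain ⟨v, hv, hfv⟩ := h.2 u hu
    rw [hfv, hv, Complex.ofReal_re]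
  have hc := circleDeriv_eq hre.continuousAt hlift
  rw [hre.deriv] at hc
  rw [hc, show (((deriv F t).re : ℝ) : ℂ) = deriv F t from Complex.ext (by simp) (by simp [him0])]
  exact hd

/-- The derivative of an analytic diffeomorphism of the circle. -/
noncomputable abbrev DiffAn.D (g : DiffAn) (x : S1) : ℝ := circleDeriv g.app x

theorem exists_isLift (g : DiffAn) (t : ℝ) :
    ∃ ρ > 0, ∃ F, IsLift g.app (Metric.ball (t : ℂ) ρ) F := by
  obtain ⟨F, hF, hgF⟩ := g.2.1 (t : S1) t rfl
  obtain ⟨ρ, hρ, H, hH, hHF⟩ := exists_complexification hF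
  obtain ⟨ρ', hρ', hball⟩ := Metric.eventually_nhds_iff.mp hgF
  refine ⟨min ρ ρ', lt_min hρ hρ', H,
    hH.mono (Metric.ball_subset_ball (min_le_left _ _)), fun u hu => ⟨F u, ?_, ?_⟩⟩
  · exact hHF u (Metric.ball_subset_ball (min_le_left _ _) hu)
  · apply hball
    have := (Metric.mem_ball.mp hu).trans_le (min_le_right _ _)
    rwa [Complex.isometry_ofReal.dist_eq] at this

theorem DiffAn.D_mul (h g : DiffAn) (x : S1) : (h * g).D x = h.D (g.app x) * g.D x := by
  obtain ⟨t, rfl⟩ := QuotientAddGroup.mk_surjective x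
  obtain ⟨F, hF, hgF⟩ := g.2.1 (t : S1) t rfl
  obtain ⟨H, hH, hhH⟩ := h.2.1 (F t : S1) (F t) rfl
  have hgt : g.app (t : S1) = (F t : S1) := hgF.self_of_nhds
  have h1 : h.D (F t : S1) = deriv H (F t) := circleDeriv_eq hH.continuousAt hhH
  have h2 : g.D (t : S1) = deriv F t := circleDeriv_eq hF.continuousAt hgF
  have h3 : (h * g).D (t : S1) = deriv (fun u => H (F u)) t := by
    refine circleDeriv_eq (hH.continuousAt.comp hF.continuousAt) ?_
    filter_upwards [hgF, hF.continuousAt.eventually hhH] with u h4 h5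
    rw [← h5, ← h4]; rfl
  change (h * g).D (t : S1) = h.D (g.app (t : S1)) * g.D (t : S1)
  rw [hgt, h1, h2, h3]
  exact (hH.differentiableAt.hasDerivAt.comp t hF.differentiableAt.hasDerivAt).deriv

theorem DiffAn.D_one (x : S1) : (1 : DiffAn).D x = 1 := by
  obtain ⟨t, rfl⟩ := QuotientAddGroup.mk_surjective x
  have := circleDeriv_eq (f := (1 : DiffAn).app) (F := fun u : ℝ => u) (t := t)
    continuousAt_id (Eventually.of_forall fun _ => rfl)
  simpa using this

theorem DiffAn.D_inv_mul (g : DiffAn) (x : S1) : g⁻¹.D (g.app x) * g.D x = 1 := by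
  rw [← DiffAn.D_mul, inv_mul_cancel, DiffAn.D_one]

theorem DiffAn.D_ne_zero (g : DiffAn) (x : S1) : g.D x ≠ 0 :=
  right_ne_zero_of_mul_eq_one (g.D_inv_mul x)

theorem nhds_coe_S1 (t : ℝ) : 𝓝 (t : S1) = map (fun u : ℝ => (u : S1)) (𝓝 t) :=
  (QuotientAddGroup.nhds_eq _ t)

theorem DiffAn.continuous_D (g : DiffAn) : Continuous g.D := by
  rw [continuous_iff_continuousAt]
  intro x
  obtain ⟨t, rfl⟩ := QuotientAddGroup.mk_surjective x
  obtain ⟨ρ, hρ, F, hF⟩ := exists_isLift g t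
  have hmem : (t : ℂ) ∈ Metric.ball (t : ℂ) ρ := Metric.mem_ball_self hρ
  have hc : ContinuousAt (fun u : ℝ => (deriv F u).re) t := by
    have h1 : ContinuousAt (deriv F) t :=
      ((hF.1.deriv Metric.isOpen_ball).continuousOn.continuousAt (Metric.isOpen_ball.mem_nhds hmem))
    exact Complex.continuous_re.continuousAt.comp
      (ContinuousAt.comp (g := deriv F) h1 Complex.continuous_ofReal.continuousAt)
  have hev : (fun u : ℝ => g.D (u : S1)) =ᶠ[𝓝 t] fun u => (deriv F u).re := by
    filter_upwards [Complex.continuous_ofReal.continuousAt.eventually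
      (Metric.isOpen_ball.mem_nhds hmem)] with u hu
    rw [(hF.hasDerivAt Metric.isOpen_ball hu).deriv, Complex.ofReal_re]
  have := hc.congr hev.symm
  change Tendsto g.D (𝓝 (t : S1)) (𝓝 (g.D (t : S1)))
  rw [nhds_coe_S1, tendsto_map'_iff]
  exact this

theorem DiffAn.exists_abs_D_le (g : DiffAn) : ∃ C, ∀ x, |g.D x| ≤ C := by
  obtain ⟨C, hC⟩ := (isCompact_range (g.continuous_D.abs)).bddAbove
  exact ⟨C, fun x => hC ⟨x, rfl⟩⟩

end Lifts

/-! ### Bounded distortion: nearly affine lifts on balls. -/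

section Good

/-- On `s`, the map `F` is affine of slope `m` up to a relative error `δ`. -/
def NearLinearOn (F : ℂ → ℂ) (m δ : ℝ) (s : Set ℂ) : Prop :=
  ∀ z ∈ s, ∀ w ∈ s, ‖F z - F w - m * (z - w)‖ ≤ δ * |m| * ‖z - w‖

theorem NearLinearOn.mono {F : ℂ → ℂ} {m δ : ℝ} {s s' : Set ℂ} (h : NearLinearOn F m δ s)
    (hs : s' ⊆ s) : NearLinearOn F m δ s' :=
  fun z hz w hw => h z (hs hz) w (hs hw)

theorem NearLinearOn.mono_error {F : ℂ → ℂ} {m δ δ' : ℝ} {s : Set ℂ} (h : NearLinearOn F m δ s)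
    (hδ : δ ≤ δ') : NearLinearOn F m δ' s :=
  fun z hz w hw => (h z hz w hw).trans (by gcongr)

theorem NearLinearOn.norm_sub_le {F : ℂ → ℂ} {m δ : ℝ} {s : Set ℂ} (h : NearLinearOn F m δ s)
    {z w : ℂ} (hz : z ∈ s) (hw : w ∈ s) : ‖F z - F w‖ ≤ (1 + δ) * |m| * ‖z - w‖ := by
  have h1 := h z hz w hw
  have h2 := norm_sub_norm_le (F z - F w) (m * (z - w))
  rw [norm_mul, Complex.norm_real, Real.norm_eq_abs] at h2
  linarith

theorem NearLinearOn.le_norm_sub {F : ℂ → ℂ} {m δ : ℝ} {s : Set ℂ} (h : NearLinearOn F m δ s)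
    {z w : ℂ} (hz : z ∈ s) (hw : w ∈ s) : (1 - δ) * |m| * ‖z - w‖ ≤ ‖F z - F w‖ := by
  have h1 := h z hz w hw
  have h2 := norm_sub_norm_le (m * (z - w)) (F z - F w)
  rw [norm_mul, Complex.norm_real, Real.norm_eq_abs,
    norm_sub_rev (_ * (z - w))] at h2
  linarith

theorem NearLinearOn.comp {F H : ℂ → ℂ} {m n δ δ' : ℝ} {s s' : Set ℂ} (hδ : 0 ≤ δ')
    (hH : NearLinearOn H n δ' s') (hF : NearLinearOn F m δ s) (hm : MapsTo F s s') :
    NearLinearOn (fun z => H (F z)) (n * m) ((1 + δ) * (1 + δ') - 1) s := by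
  intro z hz w hw
  have h1 := hH (F z) (hm hz) (F w) (hm hw)
  have h2 := hF z hz w hw
  have h3 := hF.norm_sub_le hz hw
  have h4 : H (F z) - H (F w) - ((n * m : ℝ) : ℂ) * (z - w) =
      (H (F z) - H (F w) - n * (F z - F w)) + n * (F z - F w - m * (z - w)) := by
    push_cast; ring
  have h5 : ‖(n : ℂ) * (F z - F w - m * (z - w))‖ ≤ |n| * (δ * |m| * ‖z - w‖) := by
    rw [norm_mul, Complex.norm_real, Real.norm_eq_abs]; gcongr
  have h6 : δ' * |n| * ‖F z - F w‖ ≤ δ' * |n| * ((1 + δ) * |m| * ‖z - w‖) := by gcongr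
  calc _ ≤ ‖H (F z) - H (F w) - n * (F z - F w)‖ + ‖(n : ℂ) * (F z - F w - m * (z - w))‖ := by
        rw [h4]; exact norm_add_le _ _
    _ ≤ δ' * |n| * ((1 + δ) * |m| * ‖z - w‖) + |n| * (δ * |m| * ‖z - w‖) := by linarith
    _ = _ := by rw [abs_mul]; ring

/-- Near every representative of `y`, the diffeomorphism `g` has a holomorphic lift on the ball
of radius `ρ` that is affine up to a relative error `δ`. -/
def Good (ρ δ : ℝ) (g : DiffAn) (y : S1) : Prop :=
  ∀ t : ℝ, (t : S1) = y → ∃ A : ℂ → ℂ, IsLift g.app (Metric.ball (t : ℂ) ρ) A ∧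
    NearLinearOn A (g.D y) δ (Metric.ball (t : ℂ) ρ)

theorem Good.of_exists {ρ δ : ℝ} {g : DiffAn} {t : ℝ} {A : ℂ → ℂ}
    (hA : IsLift g.app (Metric.ball (t : ℂ) ρ) A)
    (hA' : NearLinearOn A (g.D (t : S1)) δ (Metric.ball (t : ℂ) ρ)) : Good ρ δ g (t : S1) := by
  intro s hs
  obtain ⟨n, rfl⟩ := exists_int_of_coe_eq hs
  refine ⟨_, hA.translate n, fun z hz w hw => ?_⟩
  have hm : ∀ z, z ∈ Metric.ball ((t + n : ℝ) : ℂ) ρ → z - n ∈ Metric.ball (t : ℂ) ρ := by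
    intro z hz
    rw [Metric.mem_ball, dist_eq_norm] at hz ⊢
    convert hz using 2
    push_cast; ring
  simpa using hA' _ (hm z hz) _ (hm w hw)

theorem Good.mono {ρ ρ' δ δ' : ℝ} {g : DiffAn} {y : S1} (h : Good ρ δ g y) (hρ : ρ' ≤ ρ)
    (hδ : δ ≤ δ') : Good ρ' δ' g y := fun t ht => by
  obtain ⟨A, hA, hA'⟩ := h t ht
  exact ⟨A, hA.mono (Metric.ball_subset_ball hρ),
    (hA'.mono (Metric.ball_subset_ball hρ)).mono_error hδ⟩

theorem Good.one {ρ : ℝ} (y : S1) : Good ρ 0 1 y := fun t ht =>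
  ⟨fun z => z, ⟨differentiableOn_id, fun u _ => ⟨u, rfl, rfl⟩⟩, fun z _ w _ => by
    rw [DiffAn.D_one]; simp⟩

/-- Distortion factors 1 + δ multiply under composition, provided that the image of the ball, of
radius at most (1 + δ)|Dg(y)|ρ, fits in the domain of the next lift. This makes distortion along a
long orbit summable. -/
theorem Good.mul {ρ σ δ δ' : ℝ} {g h : DiffAn} {y : S1} (hδ : 0 ≤ δ) (hδ' : 0 ≤ δ')
    (hρ : 0 < ρ) (hg : Good ρ δ g y)
    (hh : Good σ δ' h (g.app y)) (hσ : (1 + δ) * |g.D y| * ρ ≤ σ) :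
    Good ρ ((1 + δ) * (1 + δ') - 1) (h * g) y := by
  intro t ht
  obtain ⟨A, hA, hA'⟩ := hg t ht
  have hmem : (t : ℂ) ∈ Metric.ball (t : ℂ) ρ := Metric.mem_ball_self hρ
  obtain ⟨s, hs, hgs⟩ := hA.2 t hmem
  obtain ⟨B, hB, hB'⟩ := hh s (by rw [← hgs, ht])
  have hm : MapsTo A (Metric.ball (t : ℂ) ρ) (Metric.ball (s : ℂ) σ) := by
    intro z hz
    have h1 := hA'.norm_sub_le hz hmem
    rw [Metric.mem_ball, dist_eq_norm] at hz ⊢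
    rw [hs] at h1
    have h2 : 0 < (1 + δ) * |g.D y| := mul_pos (by linarith) (abs_pos.mpr (g.D_ne_zero y))
    nlinarith
  refine ⟨_, hB.comp hA hm, ?_⟩
  rw [DiffAn.D_mul]
  exact hB'.comp hδ' hA' hm

/-- The derivative of the lift is Lipschitz near y and bounded away from 0, so by the mean value
inequality the relative error on a ball is proportional to its radius. This linear dependence gives
a geometric series in `exists_good_itinerary`. -/
theorem exists_nhds_good (g : DiffAn) (y : S1) : ∃ ρ > 0, ∃ C ≥ 0, ∀ᶠ y' in 𝓝 y,
    ∀ r ≤ ρ, 0 < r → Good r (C * r) g y' := by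
  obtain ⟨t, rfl⟩ := QuotientAddGroup.mk_surjective y
  obtain ⟨ρ₁, hρ₁, F, hF⟩ := exists_isLift g t
  have hmem : (t : ℂ) ∈ Metric.ball (t : ℂ) ρ₁ := Metric.mem_ball_self hρ₁
  have han : AnalyticAt ℂ (deriv F) t :=
    ((hF.1.analyticAt (Metric.isOpen_ball.mem_nhds hmem))).deriv
  obtain ⟨K, s, hs, hK⟩ := (han.contDiffAt (n := 1)).exists_lipschitzOnWith
  obtain ⟨ρ₂, hρ₂, hball⟩ := Metric.mem_nhds_iff.mp hs
  have hD0 : 0 < |g.D (t : S1)| := abs_pos.mpr (g.D_ne_zero _)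
  set ρ := min ρ₁ ρ₂ / 2 with hρ
  have hρpos : 0 < ρ := by positivity
  set C := K / (|g.D (t : S1)| / 2) with hC
  have hC0 : 0 ≤ C := by positivity
  refine ⟨ρ, hρpos, C, hC0, ?_⟩
  have hDev : ∀ᶠ y' in 𝓝 (t : S1), |g.D (t : S1)| / 2 < |g.D y'| :=
    g.continuous_D.abs.continuousAt.eventually_const_lt (half_lt_self hD0)
  change ∀ᶠ y' in 𝓝 (t : S1), _
  rw [nhds_coe_S1, eventually_map] at hDev ⊢
  filter_upwards [hDev, Metric.ball_mem_nhds t hρpos] with u hu hut r hr hr0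
  have hsub : Metric.ball (u : ℂ) r ⊆ Metric.ball (t : ℂ) (2 * ρ) := by
    apply Metric.ball_subset_ball'
    rw [Complex.isometry_ofReal.dist_eq]
    rw [Metric.mem_ball] at hut
    linarith
  have hsub1 : Metric.ball (u : ℂ) r ⊆ Metric.ball (t : ℂ) ρ₁ :=
    hsub.trans (Metric.ball_subset_ball (by rw [hρ]; linarith [min_le_left ρ₁ ρ₂]))
  have hsub2 : Metric.ball (u : ℂ) r ⊆ s :=
    (hsub.trans (Metric.ball_subset_ball (by rw [hρ]; linarith [min_le_right ρ₁ ρ₂]))).trans hball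
  have humem : (u : ℂ) ∈ Metric.ball (u : ℂ) r := Metric.mem_ball_self hr0
  refine Good.of_exists (hF.mono hsub1) fun z hz w hw => ?_
  have hDu : deriv F u = g.D (u : S1) :=
    (hF.hasDerivAt Metric.isOpen_ball (hsub1 humem)).deriv
  have hder : ∀ z ∈ Metric.ball (u : ℂ) r,
      HasDerivWithinAt (fun z => F z - (g.D (u : S1) : ℂ) * z) (deriv F z - g.D (u : S1))
        (Metric.ball (u : ℂ) r) z := by
    intro z hz
    have h1 : HasDerivAt F (deriv F z) z :=
      (hF.1.differentiableAt (Metric.isOpen_ball.mem_nhds (hsub1 hz))).hasDerivAt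
    have h2 := h1.sub ((hasDerivAt_id z).const_mul (g.D (u : S1) : ℂ))
    rw [mul_one] at h2
    exact h2.hasDerivWithinAt
  have hbd : ∀ z ∈ Metric.ball (u : ℂ) r, ‖deriv F z - g.D (u : S1)‖ ≤ K * r := by
    intro z hz
    rw [← hDu]
    refine (hK.norm_sub_le (hsub2 hz) (hsub2 humem)).trans ?_
    rw [Metric.mem_ball, dist_eq_norm] at hz
    gcongr
  have := (convex_ball (u : ℂ) r).norm_image_sub_le_of_norm_hasDerivWithin_le hder hbd hw hz
  calc _ = ‖F z - (g.D (u : S1) : ℂ) * z - (F w - (g.D (u : S1) : ℂ) * w)‖ := by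
        congr 1; ring
    _ ≤ K * r * ‖z - w‖ := this
    _ ≤ _ := by
        have h1 : (K : ℝ) * r = C * r * (|g.D (t : S1)| / 2) := by rw [hC]; field_simp
        rw [h1]
        gcongr

theorem exists_good (g : DiffAn) : ∃ ρ > 0, ∃ C ≥ 0, ∀ y : S1,
    ∀ r ≤ ρ, 0 < r → Good r (C * r) g y := by
  have := (isCompact_univ (X := S1)).induction_on
    (p := fun s => ∃ ρ > 0, ∃ C ≥ 0, ∀ y ∈ s, ∀ r ≤ ρ, 0 < r → Good r (C * r) g y)
    ⟨1, one_pos, 0, le_rfl, by simp⟩ ?_ ?_ ?_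
  · obtain ⟨ρ, hρ, C, hC, h⟩ := this
    exact ⟨ρ, hρ, C, hC, fun y => h y (mem_univ y)⟩
  · rintro s t hst ⟨ρ, hρ, C, hC, h⟩
    exact ⟨ρ, hρ, C, hC, fun y hy => h y (hst hy)⟩
  · rintro s t ⟨ρ, hρ, C, hC, h⟩ ⟨ρ', hρ', C', hC', h'⟩
    refine ⟨min ρ ρ', lt_min hρ hρ', max C C', le_max_of_le_left hC, fun y hy r hr hr0 => ?_⟩
    rcases hy with hy | hy
    · exact (h y hy r (hr.trans (min_le_left _ _)) hr0).mono le_rfl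
        (by gcongr; exact le_max_left _ _)
    · exact (h' y hy r (hr.trans (min_le_right _ _)) hr0).mono le_rfl
        (by gcongr; exact le_max_right _ _)
  · intro y _
    obtain ⟨ρ, hρ, C, hC, h⟩ := exists_nhds_good g y
    exact ⟨_, mem_nhdsWithin_of_mem_nhds h, ρ, hρ, C, hC, fun y' hy' => hy'⟩

theorem exists_good_of_finite {S : Set DiffAn} (hS : S.Finite) : ∃ ρ > 0, ∃ C ≥ 0, ∀ g ∈ S,
    ∀ y : S1, ∀ r ≤ ρ, 0 < r → Good r (C * r) g y := by
  induction S, hS using Set.Finite.induction_on with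
  | empty => exact ⟨1, one_pos, 0, le_rfl, by simp⟩
  | insert _ _ ih =>
    rename_i g S _ _
    obtain ⟨ρ, hρ, C, hC, h⟩ := ih
    obtain ⟨ρ', hρ', C', hC', h'⟩ := exists_good g
    refine ⟨min ρ ρ', lt_min hρ hρ', max C C', le_max_of_le_left hC, fun k hk y r hr hr0 => ?_⟩
    rcases hk with rfl | hk
    · exact (h' y r (hr.trans (min_le_right _ _)) hr0).mono le_rfl
        (by gcongr; exact le_max_right _ _)
    · exact (h k hk y r (hr.trans (min_le_left _ _)) hr0).mono le_rfl
        (by gcongr; exact le_max_left _ _)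

end Good

/-! ### Inverting nearly affine lifts. -/

section Transition

theorem eq_zero_of_norm_intCast_lt {n : ℤ} (h : ‖(n : ℂ)‖ < 1) : n = 0 := by
  rw [Complex.norm_intCast] at h
  exact Int.abs_lt_one_iff.mp (by exact_mod_cast h)

theorem NearLinearOn.injOn {F : ℂ → ℂ} {m δ : ℝ} {s : Set ℂ} (h : NearLinearOn F m δ s)
    (hm : m ≠ 0) (hδ : δ < 1) : InjOn F s := by
  intro z hz w hw hzw
  have h1 := h.le_norm_sub hz hw
  rw [hzw, sub_self, norm_zero] at h1
  have h2 : 0 < (1 - δ) * |m| := mul_pos (by linarith) (abs_pos.mpr hm)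
  have h3 : ‖z - w‖ ≤ 0 := by
    by_contra! h4
    exact absurd (mul_pos h2 h4) (not_lt.mpr h1)
  exact sub_eq_zero.mp (norm_le_zero_iff.mp h3)

/-- A nearly linear lift of `b` is invertible, and its inverse is a lift of `b⁻¹` on a ball of
controlled size. -/
theorem exists_inverse_lift {b : DiffAn} {t ρ m : ℝ} {A : ℂ → ℂ} (hρ : 0 < ρ) (hm : m ≠ 0)
    (hA : IsLift b.app (Metric.ball (t : ℂ) ρ) A)
    (hA' : NearLinearOn A m (1 / 2) (Metric.ball (t : ℂ) ρ)) :
    ∃ B : ℂ → ℂ, IsLift (b⁻¹ : DiffAn).app (Metric.ball (A t) (|m| * ρ / 8)) B ∧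
      ∀ w ∈ Metric.ball (A t) (|m| * ρ / 8), B w ∈ Metric.ball (t : ℂ) ρ ∧ A (B w) = w := by
  have hm0 : 0 < |m| := abs_pos.mpr hm
  have htmem : (t : ℂ) ∈ Metric.ball (t : ℂ) ρ := Metric.mem_ball_self hρ
  have hinj := hA'.injOn hm (by norm_num)
  have hcl : Metric.closedBall (t : ℂ) (ρ / 2) ⊆ Metric.ball (t : ℂ) ρ :=
    Metric.closedBall_subset_ball (by linarith)
  have hsurj : ∀ w ∈ Metric.ball (A t) (|m| * ρ / 8),
      ∃ z ∈ Metric.closedBall (t : ℂ) (ρ / 2), A z = w := by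
    have h1 : DiffContOnCl ℂ A (Metric.ball (t : ℂ) (ρ / 2)) :=
      (hA.1.mono (closure_ball (t : ℂ) (by positivity : ρ / 2 ≠ 0) ▸ hcl)).diffContOnCl
    -- Input for the quantitative open mapping theorem, which covers a ball of half this size; hence
    -- the radius |m|ρ/8.
    have h2 : ∀ z ∈ Metric.sphere (t : ℂ) (ρ / 2), |m| * ρ / 4 ≤ ‖A z - A t‖ := by
      intro z hz
      have h3 := hA'.le_norm_sub (hcl (Metric.sphere_subset_closedBall hz)) htmem
      rw [mem_sphere_iff_norm] at hz
      rw [hz] at h3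
      linarith
    have h3 : ∃ᶠ z in 𝓝 (t : ℂ), A z ≠ A t := by
      have h4 : ∀ᶠ z in 𝓝[≠] (t : ℂ), A z ≠ A t := by
        rw [eventually_nhdsWithin_iff]
        filter_upwards [Metric.isOpen_ball.mem_nhds htmem] with z hz hzt hAz
        exact hzt (hinj hz htmem hAz)
      exact h4.frequently.filter_mono nhdsWithin_le_nhds
    have h4 := h1.ball_subset_image_closedBall (by positivity) h2 h3
    rw [show |m| * ρ / 4 / 2 = |m| * ρ / 8 by ring] at h4
    exact fun w hw => h4 hw
  choose! B hB hAB using hsurj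
  have hB' : ∀ w ∈ Metric.ball (A t) (|m| * ρ / 8), B w ∈ Metric.ball (t : ℂ) ρ :=
    fun w hw => hcl (hB w hw)
  have hcont : ∀ w ∈ Metric.ball (A t) (|m| * ρ / 8), ContinuousAt B w := by
    have hlip : LipschitzOnWith (Real.toNNReal (2 / |m|)) B (Metric.ball (A t) (|m| * ρ / 8)) := by
      refine LipschitzOnWith.of_dist_le_mul fun z hz w hw => ?_
      rw [dist_eq_norm, dist_eq_norm, Real.coe_toNNReal _ (by positivity)]
      have h1 := hA'.le_norm_sub (hB' z hz) (hB' w hw)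
      rw [hAB z hz, hAB w hw] at h1
      rw [div_mul_eq_mul_div, le_div_iff₀ hm0]
      linarith
    exact fun w hw => hlip.continuousOn.continuousAt (Metric.isOpen_ball.mem_nhds hw)
  refine ⟨B, ⟨fun w hw => ?_, fun v hv => ?_⟩, fun w hw => ⟨hB' w hw, hAB w hw⟩⟩
  · have h1 : HasDerivAt A (deriv A (B w)) (B w) :=
      (hA.1.differentiableAt (Metric.isOpen_ball.mem_nhds (hB' w hw))).hasDerivAt
    -- A vanishing derivative would contradict the lower Lipschitz bound |m|/2 of `A`.
    have h2 : deriv A (B w) ≠ 0 := by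
      intro h0
      rw [h0, hasDerivAt_iff_isLittleO] at h1
      have h3 := h1.def (show (0 : ℝ) < |m| / 4 by positivity)
      have h4 : ∀ᶠ z in 𝓝[≠] (B w), False := by
        rw [eventually_nhdsWithin_iff]
        filter_upwards [h3, Metric.isOpen_ball.mem_nhds (hB' w hw)] with z h5 h6 h7
        have h8 := hA'.le_norm_sub h6 (hB' w hw)
        simp only [smul_zero, sub_zero] at h5
        have h9 : 0 < ‖z - B w‖ := norm_pos_iff.mpr (sub_ne_zero.mpr h7)
        nlinarith [mul_pos hm0 h9]
      simp at h4
      exact (NeBot.ne inferInstance) h4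
    refine (HasDerivAt.of_local_left_inverse (hcont w hw) h1 h2 ?_).differentiableAt.differentiableWithinAt
    filter_upwards [Metric.isOpen_ball.mem_nhds hw] with z hz using hAB z hz
  -- The inverse must be real on real points: the intermediate value theorem yields a real preimage
  -- u of v, and injectivity forces `B v = u`.
  · have hreal : ∀ u : ℝ, |u - t| ≤ ρ / 2 → (u : ℂ) ∈ Metric.closedBall (t : ℂ) (ρ / 2) := by
      intro u hu
      rwa [Metric.mem_closedBall, Complex.isometry_ofReal.dist_eq, Real.dist_eq]
    have hAre : ∀ u : ℝ, |u - t| ≤ ρ / 2 → A u = (((A u).re : ℝ) : ℂ) := by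
      intro u hu
      obtain ⟨v', hv', -⟩ := hA.2 u (hcl (hreal u hu))
      rw [hv', Complex.ofReal_re]
    have hest : ∀ u : ℝ, |u - t| ≤ ρ / 2 →
        |(A u).re - (A t).re - m * (u - t)| ≤ 1 / 2 * |m| * |u - t| := by
      intro u hu
      have h1 := hA' u (hcl (hreal u hu)) t htmem
      rw [hAre u hu, hAre t (by simp; positivity)] at h1
      rw [← Real.norm_eq_abs, ← Complex.norm_real, ← Real.norm_eq_abs (u - t),
        ← Complex.norm_real (u - t)]
      push_cast
      exact h1
    have hvr : |v - (A t).re| < |m| * ρ / 8 := by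
      rw [Metric.mem_ball, hAre t (by simp; positivity), Complex.isometry_ofReal.dist_eq,
        Real.dist_eq] at hv
      exact hv
    have hcontA : ContinuousOn (fun u : ℝ => (A u).re) (uIcc (t - ρ / 2) (t + ρ / 2)) := by
      refine Complex.continuous_re.comp_continuousOn
        (hA.1.continuousOn.comp Complex.continuous_ofReal.continuousOn fun u hu => hcl (hreal u ?_))
      rw [uIcc_of_le (by linarith), mem_Icc] at hu
      rw [abs_le]; constructor <;> linarith
    have hIVT := intermediate_value_uIcc hcontA
    have hρ2 : |ρ / 2| = ρ / 2 := abs_of_pos (by positivity)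
    have e1 := hest (t - ρ / 2) (by simp [hρ2])
    have e2 := hest (t + ρ / 2) (by simp [hρ2])
    rw [show t - ρ / 2 - t = -(ρ / 2) by ring, abs_neg, hρ2] at e1
    rw [show t + ρ / 2 - t = ρ / 2 by ring, hρ2] at e2
    rw [abs_lt] at hvr
    rw [abs_le] at e1 e2
    have hmem : v ∈ uIcc ((A (t - ρ / 2 : ℝ)).re) ((A (t + ρ / 2 : ℝ)).re) := by
      have hpos : 0 < |m| * ρ := mul_pos hm0 hρ
      rw [mem_uIcc]
      rcases abs_cases m with ⟨h, -⟩ | ⟨h, -⟩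
      · left; rw [h] at e1 e2 hvr hpos; constructor <;> linarith
      · right; rw [h] at e1 e2 hvr hpos; constructor <;> linarith
    obtain ⟨u, hu, huv⟩ := hIVT hmem
    rw [uIcc_of_le (by linarith), mem_Icc] at hu
    have hu' : |u - t| ≤ ρ / 2 := by rw [abs_le]; constructor <;> linarith
    have hAu : A u = v := by rw [hAre u hu']; exact congrArg _ huv
    refine ⟨u, hinj (hB' v hv) (hcl (hreal u hu')) ((hAB v hv).trans hAu.symm), ?_⟩
    obtain ⟨v', hv', hbv⟩ := hA.2 u (hcl (hreal u hu'))
    have : v' = v := by exact_mod_cast hv'.symm.trans hAu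
    rw [← this, ← hbv]
    exact Equiv.symm_apply_apply (b : Equiv.Perm S1) _

end Transition

/-! ### Compactness: infinitely many tame elements accumulate at the identity. -/

section Finiteness

/-- `c` and `c⁻¹` have mutually inverse Lipschitz holomorphic lifts on balls of radius `κ` around
real points `t` and `s` of `[0, 1]`. -/
structure Tame (κ L : ℝ) (c : DiffAn) (t s : ℝ) (C C' : ℂ → ℂ) : Prop where
  ht : t ∈ Icc (0 : ℝ) 1
  hs : s ∈ Icc (0 : ℝ) 1
  lift : IsLift c.app (Metric.ball (t : ℂ) κ) C
  lift' : IsLift (c⁻¹ : DiffAn).app (Metric.ball (s : ℂ) κ) C'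
  apply_center : C t = s
  lip : ∀ z ∈ Metric.ball (t : ℂ) κ, ∀ w ∈ Metric.ball (t : ℂ) κ, ‖C z - C w‖ ≤ L * ‖z - w‖
  lip' : ∀ z ∈ Metric.ball (s : ℂ) κ, ∀ w ∈ Metric.ball (s : ℂ) κ, ‖C' z - C' w‖ ≤ L * ‖z - w‖
  leftInv : ∀ z ∈ Metric.ball (t : ℂ) κ, C z ∈ Metric.ball (s : ℂ) κ → C' (C z) = z

/-- The transition between two nearly linear maps of comparable slopes. -/
theorem exists_transition {ρ E m₁ m₂ : ℝ} (hρ : 0 < ρ) (hE : 1 ≤ E) (hm₂ : m₂ ≠ 0)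
    (hm : |m₁| ≤ E * |m₂|) {b₁ b₂ : DiffAn} {t₁ t₂ : ℝ} {A₁ A₂ : ℂ → ℂ}
    (h₁ : IsLift b₁.app (Metric.ball (t₁ : ℂ) ρ) A₁)
    (h₁' : NearLinearOn A₁ m₁ (1 / 2) (Metric.ball (t₁ : ℂ) ρ))
    (h₂ : IsLift b₂.app (Metric.ball (t₂ : ℂ) ρ) A₂)
    (h₂' : NearLinearOn A₂ m₂ (1 / 2) (Metric.ball (t₂ : ℂ) ρ)) (hc : A₁ t₁ = A₂ t₂) :
    ∃ C : ℂ → ℂ, IsLift (b₂⁻¹ * b₁ : DiffAn).app (Metric.ball (t₁ : ℂ) (ρ / (12 * E))) C ∧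
      (∀ z ∈ Metric.ball (t₁ : ℂ) (ρ / (12 * E)), ∀ w ∈ Metric.ball (t₁ : ℂ) (ρ / (12 * E)),
        ‖C z - C w‖ ≤ 3 * E * ‖z - w‖) ∧
      ∀ z ∈ Metric.ball (t₁ : ℂ) (ρ / (12 * E)),
        C z ∈ Metric.ball (t₂ : ℂ) ρ ∧ A₂ (C z) = A₁ z := by
  have hm₂0 : 0 < |m₂| := abs_pos.mpr hm₂
  obtain ⟨B, hB, hB'⟩ := exists_inverse_lift hρ hm₂ h₂ h₂'
  have hsub : Metric.ball (t₁ : ℂ) (ρ / (12 * E)) ⊆ Metric.ball (t₁ : ℂ) ρ := by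
    apply Metric.ball_subset_ball
    rw [div_le_iff₀ (by linarith)]
    nlinarith
  -- The slope of `A₁` is at most (3/2)E|m₂|, so the radius ρ/(12E) is sent into |m₂|ρ/8, the domain
  -- of the inverse of `A₂`.
  have hmaps : MapsTo A₁ (Metric.ball (t₁ : ℂ) (ρ / (12 * E)))
      (Metric.ball (A₂ t₂) (|m₂| * ρ / 8)) := by
    intro z hz
    have h1 := h₁'.norm_sub_le (hsub hz) (Metric.mem_ball_self hρ)
    rw [Metric.mem_ball, dist_eq_norm] at hz ⊢
    rw [lt_div_iff₀ (by linarith)] at hz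
    rw [← hc]
    refine h1.trans_lt ?_
    have h2 : (1 + 1 / 2) * |m₁| * ‖z - t₁‖ ≤ (1 + 1 / 2) * (E * |m₂|) * ‖z - t₁‖ := by gcongr
    nlinarith
  refine ⟨fun z => B (A₁ z), hB.comp (h₁.mono hsub) hmaps, fun z hz w hw => ?_,
    fun z hz => hB' _ (hmaps hz)⟩
  have h1 := h₂'.le_norm_sub (hB' _ (hmaps hz)).1 (hB' _ (hmaps hw)).1
  rw [(hB' _ (hmaps hz)).2, (hB' _ (hmaps hw)).2] at h1
  have h2 := h₁'.norm_sub_le (hsub hz) (hsub hw)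
  have h3 : (1 + 1 / 2) * |m₁| * ‖z - w‖ ≤ (1 + 1 / 2) * (E * |m₂|) * ‖z - w‖ := by gcongr
  have h4 : |m₂| * ‖B (A₁ z) - B (A₁ w)‖ ≤ |m₂| * (3 * E * ‖z - w‖) := by linarith
  exact le_of_mul_le_mul_left h4 hm₂0

theorem exists_rep_Icc (y : S1) : ∃ t : ℝ, t ∈ Icc (0 : ℝ) 1 ∧ (t : S1) = y := by
  obtain ⟨t, rfl⟩ := QuotientAddGroup.mk_surjective y
  refine ⟨Int.fract t, ⟨Int.fract_nonneg t, (Int.fract_lt_one t).le⟩, ?_⟩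
  have := coe_add_int (Int.fract t) ⌊t⌋
  rw [Int.fract_add_floor] at this
  exact this.symm

/-- Lifts are determined only up to an integer: one of them is shifted so that both agree at their
centres. Taking the centres in [0, 1] keeps the transitions uniformly bounded. -/
theorem exists_tame {ρ E : ℝ} (hρ : 0 < ρ) (hE : 1 ≤ E) {b₁ b₂ : DiffAn} {y₁ y₂ : S1}
    (h₁ : Good ρ (1 / 2) b₁ y₁) (h₂ : Good ρ (1 / 2) b₂ y₂) (hb : b₁.app y₁ = b₂.app y₂)
    (h₁₂ : |b₁.D y₁| ≤ E * |b₂.D y₂|) (h₂₁ : |b₂.D y₂| ≤ E * |b₁.D y₁|) :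
    ∃ (t s : ℝ) (C C' : ℂ → ℂ), (t : S1) = y₁ ∧ Tame (ρ / (12 * E)) (3 * E) (b₂⁻¹ * b₁) t s C C' := by
  obtain ⟨t, ht, rfl⟩ := exists_rep_Icc y₁
  obtain ⟨s, hs, rfl⟩ := exists_rep_Icc y₂
  obtain ⟨A₁, hA₁, hA₁'⟩ := h₁ t rfl
  obtain ⟨A₀, hA₀, hA₀'⟩ := h₂ s rfl
  have htm : (t : ℂ) ∈ Metric.ball (t : ℂ) ρ := Metric.mem_ball_self hρ
  have hsm : (s : ℂ) ∈ Metric.ball (s : ℂ) ρ := Metric.mem_ball_self hρ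
  obtain ⟨x₁, hx₁, hbx₁⟩ := hA₁.2 t htm
  obtain ⟨x₂, hx₂, hbx₂⟩ := hA₀.2 s hsm
  obtain ⟨n, hn⟩ : ∃ n : ℤ, x₁ = x₂ + n := exists_int_of_coe_eq (by rw [← hbx₁, ← hbx₂, hb])
  obtain ⟨A₂, rfl⟩ : ∃ A₂, A₂ = fun z => A₀ z + n := ⟨_, rfl⟩
  have hA₂ := hA₀.add_int n
  have hA₂' : NearLinearOn (fun z => A₀ z + n) (b₂.D (s : S1)) (1 / 2)
      (Metric.ball (s : ℂ) ρ) := fun z hz w hw => by simpa using hA₀' z hz w hw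
  have hc : A₁ t = (fun z => A₀ z + n) (s : ℂ) := by
    simp only [hx₁, hx₂, hn]; push_cast; rfl
  obtain ⟨C, hC, hClip, hC2⟩ := exists_transition hρ hE (b₂.D_ne_zero _) h₁₂
    hA₁ hA₁' hA₂ hA₂' hc
  obtain ⟨C', hC', hClip', hC2'⟩ := exists_transition hρ hE (b₁.D_ne_zero _) h₂₁
    hA₂ hA₂' hA₁ hA₁' hc.symm
  have hκ : 0 < ρ / (12 * E) := by positivity
  have hκρ : ρ / (12 * E) ≤ ρ := by
    rw [div_le_iff₀ (by linarith)]; nlinarith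
  refine ⟨t, s, C, C', rfl, ht, hs, hC, ?_, ?_, hClip, hClip', ?_⟩
  · rwa [show (b₂⁻¹ * b₁)⁻¹ = b₁⁻¹ * b₂ by group]
  · have h := hC2 t (Metric.mem_ball_self hκ)
    exact hA₂'.injOn (b₂.D_ne_zero _) (by norm_num) h.1 hsm (h.2.trans hc)
  · intro z hz hCz
    have h := hC2' _ hCz
    exact hA₁'.injOn (b₁.D_ne_zero _) (by norm_num) h.1 (Metric.ball_subset_ball hκρ hz)
      (h.2.trans (hC2 z hz).2)

/-- Among infinitely many uniformly bounded and uniformly Lipschitz functions on a totally bounded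
set, two are uniformly close. -/
theorem exists_ne_uniformly_close {ι : Type*} [Infinite ι] {s : Set ℂ} (hs : TotallyBounded s)
    {L M : ℝ} (hL : 0 < L) (f : ι → ℂ → ℂ)
    (hlip : ∀ i, ∀ z ∈ s, ∀ w ∈ s, ‖f i z - f i w‖ ≤ L * ‖z - w‖)
    (hM : ∀ i, ∀ z ∈ s, ‖f i z‖ ≤ M) {ε : ℝ} (hε : 0 < ε) :
    ∃ i j, i ≠ j ∧ ∀ z ∈ s, ‖f i z - f j z‖ ≤ ε := by
  -- On a finite net the values live in a compact ball of a finite-dimensional space, so two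
  -- functions agree there up to ε/2; moving from the net to any point costs ε/4 for each.
  obtain ⟨T, hTs, hTfin, hT⟩ := Metric.finite_approx_of_totallyBounded hs (ε / (4 * L))
    (by positivity)
  have : Fintype T := hTfin.fintype
  have hM0 : 0 ≤ max M 0 := le_max_right _ _
  set F : ℕ → (T → ℂ) := fun k z => f (Infinite.natEmbedding ι k) z with hF
  have hFmem : ∀ k, F k ∈ Metric.closedBall (0 : T → ℂ) (max M 0) := by
    intro k
    rw [mem_closedBall_zero_iff, pi_norm_le_iff_of_nonneg hM0]
    exact fun z => (hM _ z (hTs z.2)).trans (le_max_left _ _)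
  obtain ⟨a, -, φ, hφ, hlim⟩ := (isCompact_closedBall (0 : T → ℂ) (max M 0)).tendsto_subseq hFmem
  obtain ⟨N, hN⟩ := Metric.cauchySeq_iff'.mp hlim.cauchySeq (ε / 2) (by positivity)
  refine ⟨Infinite.natEmbedding ι (φ (N + 1)), Infinite.natEmbedding ι (φ N), ?_, fun z hz => ?_⟩
  · intro h
    have := hφ ((Nat.lt_succ_self N))
    exact this.ne' ((Infinite.natEmbedding ι).injective h)
  · obtain ⟨w, hw, hzw⟩ := mem_iUnion₂.mp (hT hz)
    rw [Metric.mem_ball, dist_eq_norm] at hzw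
    have h1 := hN (N + 1) (Nat.le_succ N)
    rw [dist_eq_norm] at h1
    have h2 := (norm_le_pi_norm ((F ∘ φ) (N + 1) - (F ∘ φ) N) ⟨w, hw⟩).trans h1.le
    have h3 : ∀ i, ‖f i z - f i w‖ ≤ ε / 4 := by
      intro i
      refine (hlip i z hz w (hTs hw)).trans ?_
      calc L * ‖z - w‖ ≤ L * (ε / (4 * L)) := by gcongr
        _ = ε / 4 := by field_simp
    set i := Infinite.natEmbedding ι (φ (N + 1))
    set j := Infinite.natEmbedding ι (φ N)
    have h4 : ‖f i w - f j w‖ ≤ ε / 2 := h2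
    have h5 : f i z - f j z = (f i z - f i w) + (f i w - f j w) - (f j z - f j w) := by ring
    rw [h5]
    refine (norm_sub_le _ _).trans ?_
    linarith [norm_add_le (f i z - f i w) (f i w - f j w), h3 i, h3 j]

/-- Non-trivial elements of `G` have holomorphic lifts arbitrarily close to the identity on a fixed
ball around `t`. -/
def AccumulatesAt (G : Subgroup DiffAn) (t : ℝ) : Prop :=
  ∃ r > 0, ∀ ε > 0, ∃ g ∈ G, g ≠ 1 ∧ ∃ F, IsLift g.app (Metric.ball (t : ℂ) r) F ∧
    ∀ z ∈ Metric.ball (t : ℂ) r, ‖F z - z‖ ≤ ε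

/-- If the lifts of c ≠ c' are uniformly close, then c'⁻¹c has a lift close to the identity. The
predicate `P` records that the accumulation point is the centre of one of the given lifts, so that
it stays on the orbit of x. -/
theorem accumulatesAt_of_infinite_tame {G : Subgroup DiffAn} {X : Set DiffAn} (hXG : ∀ c ∈ X, c ∈ G)
    (hX : X.Infinite) {κ L : ℝ} (hκ : 0 < κ) (hL : 1 ≤ L) {P : S1 → Prop}
    (htame : ∀ c ∈ X, ∃ (t s : ℝ) (C C' : ℂ → ℂ), P (t : S1) ∧ Tame κ L c t s C C') :
    ∃ t : ℝ, P (t : S1) ∧ AccumulatesAt G t := by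
  choose! t s C C' hP hC using htame
  have hL0 : 0 < L := by linarith
  set r := κ / (4 * L) with hr
  have hr0 : 0 < r := by positivity
  have hLr : L * (2 * r) = κ / 2 := by rw [hr]; field_simp; norm_num
  have hrκ : 2 * r < κ := by nlinarith
  have := hX.to_subtype
  -- Pigeonhole on the centres: infinitely many lie in one interval of length r, and the ball of
  -- radius r around one of them, chosen before ε, serves for all.
  set ψ : X → Fin (⌊1 / r⌋₊ + 1) := fun c => ⟨⌊t c / r⌋₊, Nat.lt_succ_of_le (Nat.floor_mono (by
    have := (hC c c.2).ht.2; gcongr))⟩ with hψ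
  obtain ⟨q, hq⟩ := Finite.exists_infinite_fiber ψ
  have hclose : ∀ c c' : X, ⌊t c / r⌋₊ = q → ⌊t c' / r⌋₊ = q → |t c - t c'| < r := by
    intro c c' h h'
    have h1 := (Nat.floor_eq_iff (div_nonneg (hC c c.2).ht.1 hr0.le)).mp h
    have h2 := (Nat.floor_eq_iff (div_nonneg (hC c' c'.2).ht.1 hr0.le)).mp h'
    rw [le_div_iff₀ hr0, div_lt_iff₀ hr0] at h1 h2
    rw [abs_lt]; constructor <;> nlinarith
  set Y := ψ ⁻¹' {q} with hY
  have hYq : ∀ c : Y, ⌊t c.1 / r⌋₊ = q := fun c => congrArg Fin.val c.2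
  obtain ⟨c₀⟩ : Nonempty Y := inferInstance
  set t₀ := t c₀.1 with ht₀
  have hnear : ∀ c : Y, ∀ z ∈ Metric.ball (t₀ : ℂ) r, ‖z - t c.1‖ < 2 * r := by
    intro c z hz
    rw [Metric.mem_ball, dist_eq_norm] at hz
    have h1 : ‖(t₀ : ℂ) - t c.1‖ < r := by
      rw [← Complex.ofReal_sub, Complex.norm_real]
      exact hclose _ _ (hYq c₀) (hYq c)
    linarith [norm_sub_le_norm_sub_add_norm_sub z (t₀ : ℂ) (t c.1 : ℂ)]
  have hsub : ∀ c : Y, Metric.ball (t₀ : ℂ) r ⊆ Metric.ball (t c.1 : ℂ) κ := by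
    intro c z hz
    rw [Metric.mem_ball, dist_eq_norm]
    exact (hnear c z hz).trans hrκ
  have himg : ∀ c : Y, ∀ z ∈ Metric.ball (t₀ : ℂ) r, ‖C c.1 z - s c.1‖ < κ / 2 := by
    intro c z hz
    rw [← (hC c.1 c.1.2).apply_center, ← hLr]
    refine ((hC c.1 c.1.2).lip z (hsub c hz) _ (Metric.mem_ball_self hκ)).trans_lt ?_
    have := hnear c z hz
    gcongr
  refine ⟨t₀, hP _ c₀.1.2, r, hr0, fun ε hε => ?_⟩
  obtain ⟨c, c', hne, hcc⟩ := exists_ne_uniformly_close (s := Metric.ball (t₀ : ℂ) r)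
    ((isCompact_closedBall _ _).totallyBounded.subset Metric.ball_subset_closedBall) hL0 (fun c : Y => C c.1)
    (fun c z hz w hw => (hC c.1 c.1.2).lip z (hsub c hz) w (hsub c hw))
    (M := 1 + κ) (fun c z hz => by
      have h1 := himg c z hz
      have h2 : ‖(s c.1 : ℂ)‖ ≤ 1 := by
        rw [Complex.norm_real, Real.norm_of_nonneg (hC c.1 c.1.2).hs.1]
        exact (hC c.1 c.1.2).hs.2
      have h3 := norm_le_norm_sub_add (C c.1 z) (s c.1 : ℂ)
      linarith) (ε := min (ε / L) (κ / 2)) (by positivity)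
  have hmaps' : ∀ z ∈ Metric.ball (t₀ : ℂ) r, C c'.1 z ∈ Metric.ball (s c'.1 : ℂ) κ := by
    intro z hz
    rw [Metric.mem_ball, dist_eq_norm]
    linarith [himg c' z hz]
  have hmaps : MapsTo (C c.1) (Metric.ball (t₀ : ℂ) r) (Metric.ball (s c'.1 : ℂ) κ) := by
    intro z hz
    rw [Metric.mem_ball, dist_eq_norm]
    have h1 := (hcc z hz).trans (min_le_right _ _)
    linarith [himg c' z hz,
      norm_sub_le_norm_sub_add_norm_sub (C c.1 z) (C c'.1 z) (s c'.1 : ℂ)]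
  refine ⟨(c'.1 : DiffAn)⁻¹ * c.1, G.mul_mem (G.inv_mem (hXG _ c'.1.2)) (hXG _ c.1.2), ?_,
    fun z => C' c'.1 (C c.1 z),
    (hC c'.1 c'.1.2).lift'.comp ((hC c.1 c.1.2).lift.mono (hsub c)) hmaps, fun z hz => ?_⟩
  · intro h
    rw [inv_mul_eq_one] at h
    exact hne (Subtype.ext (Subtype.ext h.symm))
  · have h1 := (hC c'.1 c'.1.2).leftInv z (hsub c' hz) (hmaps' z hz)
    have h2 := (hC c'.1 c'.1.2).lip' _ (hmaps hz) _ (hmaps' z hz)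
    rw [h1] at h2
    refine h2.trans ?_
    have h3 := (hcc z hz).trans (min_le_left _ _)
    rw [le_div_iff₀ hL0] at h3
    linarith

/-- Accumulation to the identity is invariant under the group. -/
theorem AccumulatesAt.of_app_eq {G : Subgroup DiffAn} {s t : ℝ} (hs : AccumulatesAt G s)
    {h : DiffAn} (hG : h ∈ G) (hts : h.app (t : S1) = (s : S1)) : AccumulatesAt G t := by
  obtain ⟨r, hr, hacc⟩ := hs
  obtain ⟨ρ₀, hρ₀, K, hK, hgood⟩ := exists_good h
  obtain ⟨ρ, hρ, hρρ, hKρ⟩ : ∃ ρ > 0, ρ ≤ ρ₀ ∧ K * ρ ≤ 1 / 2 := by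
    refine ⟨min ρ₀ (1 / (2 * (K + 1))), by positivity, min_le_left _ _, ?_⟩
    calc K * min ρ₀ (1 / (2 * (K + 1))) ≤ (K + 1) * (1 / (2 * (K + 1))) := by
          gcongr
          · linarith
          · exact min_le_right _ _
      _ = 1 / 2 := by field_simp
  obtain ⟨H₀, hH₀, hH₀'⟩ := (hgood (t : S1) ρ hρρ hρ).mono le_rfl hKρ t rfl
  have htm : (t : ℂ) ∈ Metric.ball (t : ℂ) ρ := Metric.mem_ball_self hρ
  obtain ⟨v, hv, hhv⟩ := hH₀.2 t htm
  obtain ⟨n, hn⟩ : ∃ n : ℤ, s = v + n := exists_int_of_coe_eq (by rw [← hts, hhv])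
  set m := h.D (t : S1) with hmdef
  have hm : 0 < |m| := abs_pos.mpr (h.D_ne_zero _)
  obtain ⟨H, hHdef⟩ : ∃ H : ℂ → ℂ, H = fun z => H₀ z + n := ⟨_, rfl⟩
  have hH : IsLift h.app (Metric.ball (t : ℂ) ρ) H := hHdef ▸ hH₀.add_int n
  have hH' : NearLinearOn H m (1 / 2) (Metric.ball (t : ℂ) ρ) := fun z hz w hw => by
    simpa [hHdef] using hH₀' z hz w hw
  have hHt : H t = s := by simp only [hHdef, hv, hn]; push_cast; rfl
  obtain ⟨B, hB, hB'⟩ := exists_inverse_lift hρ (h.D_ne_zero _) hH hH'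
  rw [hHt] at hB hB'
  -- Half of the radius |m|ρ/8 on which the inverse `B` is defined is kept for H(z), the other half
  -- for the displacement caused by `F`.
  set η := min r (|m| * ρ / 16) with hη
  have hη0 : 0 < η := by positivity
  set r' := min ρ (η / (2 * |m|)) with hr'
  have hr'0 : 0 < r' := by positivity
  have hsub : Metric.ball (t : ℂ) r' ⊆ Metric.ball (t : ℂ) ρ :=
    Metric.ball_subset_ball (min_le_left _ _)
  have hHmaps : ∀ z ∈ Metric.ball (t : ℂ) r', ‖H z - s‖ < η := by
    intro z hz
    have h1 := hH'.norm_sub_le (hsub hz) htm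
    rw [hHt] at h1
    rw [Metric.mem_ball, dist_eq_norm] at hz
    have h2 := hz.trans_le (min_le_right _ _)
    rw [lt_div_iff₀ (by positivity)] at h2
    nlinarith [norm_nonneg (z - t)]
  refine ⟨r', hr'0, fun ε hε => ?_⟩
  obtain ⟨g, hg, hg1, F, hF, hF'⟩ := hacc (min (|m| * ρ / 16) (ε * |m| / 2)) (by positivity)
  have hm1 : MapsTo H (Metric.ball (t : ℂ) r') (Metric.ball (s : ℂ) r) := by
    intro z hz
    rw [Metric.mem_ball, dist_eq_norm]
    exact (hHmaps z hz).trans_le (min_le_left _ _)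
  have hm2 : ∀ z ∈ Metric.ball (t : ℂ) r', H z ∈ Metric.ball (s : ℂ) (|m| * ρ / 8) := by
    intro z hz
    rw [Metric.mem_ball, dist_eq_norm]
    have h1 := (hHmaps z hz).trans_le (min_le_right _ _)
    have : 0 < |m| * ρ := by positivity
    linarith
  have hm3 : MapsTo (fun z => F (H z)) (Metric.ball (t : ℂ) r')
      (Metric.ball (s : ℂ) (|m| * ρ / 8)) := by
    intro z hz
    rw [Metric.mem_ball, dist_eq_norm]
    have h1 := (hHmaps z hz).trans_le (min_le_right _ _)
    have h2 := (hF' _ (hm1 hz)).trans (min_le_left _ _)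
    linarith [norm_sub_le_norm_sub_add_norm_sub (F (H z)) (H z) (s : ℂ)]
  refine ⟨h⁻¹ * (g * h), G.mul_mem (G.inv_mem hG) (G.mul_mem hg hG), ?_,
    fun z => B (F (H z)), hB.comp (hF.comp (hH.mono hsub) hm1) hm3, fun z hz => ?_⟩
  · intro h1
    rw [inv_mul_eq_one] at h1
    exact hg1 (by simpa using h1.symm)
  · have h1 : B (H z) = z := hH'.injOn (h.D_ne_zero _) (by norm_num) (hB' _ (hm2 z hz)).1
      (hsub hz) (hB' _ (hm2 z hz)).2
    have h2 := hH'.le_norm_sub (hB' _ (hm3 hz)).1 (hB' _ (hm2 z hz)).1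
    rw [(hB' _ (hm3 hz)).2, (hB' _ (hm2 z hz)).2, h1] at h2
    have h3 := (hF' _ (hm1 hz)).trans (min_le_right _ _)
    have h4 : |m| * ‖B (F (H z)) - z‖ ≤ |m| * ε := by linarith
    exact le_of_mul_le_mul_left h4 hm

end Finiteness

/-! ### From lifts near the identity to univalent maps of the cylinder. -/

section Cylinder

theorem exists_int_of_coe_eq_cyl {z w : ℂ} (h : (z : Cyl) = (w : Cyl)) : ∃ n : ℤ, z = w + n := by
  rw [QuotientAddGroup.eq] at h
  obtain ⟨n, hn⟩ := h
  refine ⟨-n, ?_⟩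
  simp at hn
  push_cast
  rw [hn]; ring

theorem coe_add_int_cyl (z : ℂ) (n : ℤ) : ((z + n : ℂ) : Cyl) = (z : Cyl) := by
  rw [AddCircle.coe_add]
  have : ((n : ℂ) : Cyl) = 0 := by
    rw [AddCircle.coe_eq_zero_iff]
    exact ⟨n, by simp⟩
  rw [this, add_zero]

theorem eq_of_coe_eq_cyl {z w : ℂ} (h : (z : Cyl) = (w : Cyl)) (hzw : ‖z - w‖ < 1) : z = w := by
  obtain ⟨n, rfl⟩ := exists_int_of_coe_eq_cyl h
  rw [add_sub_cancel_left] at hzw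
  simp [eq_zero_of_norm_intCast_lt hzw]

/-- A holomorphic lift close to the identity induces a univalent extension on the cylinder. -/
theorem exists_univalent_extension {g : DiffAn} {t r ε : ℝ} (hr : 0 < r) {F : ℂ → ℂ}
    (hF : IsLift g.app (Metric.ball (t : ℂ) r) F)
    (hFε : ∀ z ∈ Metric.ball (t : ℂ) r, ‖F z - z‖ ≤ ε) (hεr : ε ≤ r / 8) (hε : ε ≤ 1 / 8)
    {r' : ℝ} (hr'r : r' ≤ r / 2) (hr' : r' ≤ 1 / 8) :
    ∃ φ : Cyl → Cyl,
      IsUnivalentExtension g ((fun z : ℂ => (z : Cyl)) '' Metric.ball (t : ℂ) r') φ ∧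
      ∀ y ∈ (fun z : ℂ => (z : Cyl)) '' Metric.ball (t : ℂ) r', dist y (φ y) ≤ ε := by
  classical
  have hsub : Metric.ball (t : ℂ) r' ⊆ Metric.ball (t : ℂ) r :=
    Metric.ball_subset_ball (by linarith)
  have hdiam : ∀ z ∈ Metric.ball (t : ℂ) r', ∀ w ∈ Metric.ball (t : ℂ) r', ‖z - w‖ < 1 / 4 := by
    intro z hz w hw
    rw [Metric.mem_ball, dist_eq_norm] at hz hw
    have := norm_sub_le_norm_sub_add_norm_sub z (t : ℂ) w
    rw [norm_sub_rev w] at hw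
    linarith
  -- Cauchy's estimate on circles of radius r/4 gives |(F - id)'| ≤ 4ε/r ≤ 1/2, which makes `F`
  -- injective.
  have hlip : ∀ z ∈ Metric.ball (t : ℂ) r', ∀ w ∈ Metric.ball (t : ℂ) r',
      ‖(F z - z) - (F w - w)‖ ≤ 1 / 2 * ‖z - w‖ := by
    intro z hz w hw
    have hd : DifferentiableOn ℂ (fun z => F z - z) (Metric.ball (t : ℂ) r) :=
      hF.1.sub differentiableOn_id
    refine (convex_ball (t : ℂ) r').norm_image_sub_le_of_norm_hasDerivWithin_le
      (f := fun z => F z - z) (f' := deriv fun z => F z - z) (fun x hx => ?_) (fun x hx => ?_) hw hz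
    · exact (hd.differentiableAt
        (Metric.isOpen_ball.mem_nhds (hsub hx))).hasDerivAt.hasDerivWithinAt
    · have hball : Metric.closedBall x (r / 4) ⊆ Metric.ball (t : ℂ) r := by
        intro u hu
        rw [Metric.mem_closedBall] at hu
        rw [Metric.mem_ball] at hx ⊢
        linarith [dist_triangle u x (t : ℂ)]
      have h1 : DiffContOnCl ℂ (fun z => F z - z) (Metric.ball x (r / 4)) :=
        (hd.mono (closure_ball x (by positivity : r / 4 ≠ 0) ▸ hball)).diffContOnCl
      refine (Complex.norm_deriv_le_of_forall_mem_sphere_norm_le (by positivity) h1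
        fun u hu => hFε u (hball (Metric.sphere_subset_closedBall hu))).trans ?_
      rw [div_le_iff₀ (by positivity)]
      linarith
  set φ : Cyl → Cyl := fun y =>
    if h : ∃ z ∈ Metric.ball (t : ℂ) r', (z : Cyl) = y then (F h.choose : Cyl) else y with hφ
  have hφz : ∀ z ∈ Metric.ball (t : ℂ) r', φ (z : Cyl) = (F z : Cyl) := by
    intro z hz
    have h : ∃ w ∈ Metric.ball (t : ℂ) r', (w : Cyl) = (z : Cyl) := ⟨z, hz, rfl⟩
    have h2 : h.choose = z :=
      eq_of_coe_eq_cyl h.choose_spec.2 ((hdiam _ h.choose_spec.1 _ hz).trans (by norm_num))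
    simp only [hφ]
    rw [dif_pos h, h2]
  refine ⟨φ, ⟨?_, ?_, ?_⟩, ?_⟩
  · rintro _ ⟨z, hz, rfl⟩ w hw
    obtain ⟨n, rfl⟩ := exists_int_of_coe_eq_cyl hw
    refine ⟨fun u => F (u - n), ?_, ?_⟩
    · have h1 : AnalyticAt ℂ F (z + n - n) := by
        rw [add_sub_cancel_right]
        exact hF.1.analyticAt (Metric.isOpen_ball.mem_nhds (hsub hz))
      exact h1.comp_of_eq (f := fun u : ℂ => u - n) (by fun_prop) rfl
    · have h1 : ContinuousAt (fun u : ℂ => u - n) (z + n) := by fun_prop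
      have h2 : ∀ᶠ u : ℂ in 𝓝 (z + n), u - n ∈ Metric.ball (t : ℂ) r' :=
        h1.eventually_mem (by
          simp only [add_sub_cancel_right]; exact Metric.isOpen_ball.mem_nhds hz)
      filter_upwards [h2] with u hu
      rw [← hφz _ hu]
      congr 1
      have := coe_add_int_cyl (u - n) n
      rw [sub_add_cancel] at this
      exact this
  · rintro _ ⟨z, hz, rfl⟩ _ ⟨w, hw, rfl⟩ hzw
    simp only [hφz z hz, hφz w hw] at hzw
    have h1 := hdiam z hz w hw
    have h2 := hFε z (hsub hz)
    have h3 := hFε w (hsub hw)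
    -- The two values differ by an integer of modulus less than 2ε + 1/4 ≤ 1/2, hence by 0.
    have h4 : F z = F w := by
      refine eq_of_coe_eq_cyl hzw ?_
      have h5 : F z - F w = (F z - z) - (F w - w) + (z - w) := by ring
      rw [h5]
      linarith [norm_add_le ((F z - z) - (F w - w)) (z - w), norm_sub_le (F z - z) (F w - w)]
    have h5 := hlip z hz w hw
    rw [h4, show F w - z - (F w - w) = -(z - w) by ring, norm_neg] at h5
    have h6 : ‖z - w‖ ≤ 0 := by linarith
    rw [sub_eq_zero.mp (norm_le_zero_iff.mp h6)]
  · rintro y ⟨z, hz, hzy⟩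
    obtain ⟨u, rfl⟩ := QuotientAddGroup.mk_surjective y
    obtain ⟨n, rfl⟩ := exists_int_of_coe_eq_cyl (hzy.trans (incl_coe u))
    have hun : (((u + n : ℝ) : ℝ) : ℂ) = (u : ℂ) + n := by push_cast; rfl
    obtain ⟨v, hv, hgv⟩ := hF.2 (u + n) (by rw [hun]; exact hsub hz)
    rw [← hzy]
    simp only [hφz _ hz]
    rw [hun] at hv
    rw [hv]
    change _ = incl (g.app (u : S1))
    rw [← coe_add_int u n, hgv, incl_coe]
  · rintro _ ⟨z, hz, rfl⟩
    simp only [hφz z hz]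
    rw [dist_eq_norm, ← AddCircle.coe_sub]
    refine (QuotientAddGroup.norm_mk_le_norm).trans ?_
    rw [norm_sub_rev]
    exact hFε z (hsub hz)

theorem AccumulatesAt.nonLocallyDiscreteAt {G : Subgroup DiffAn} {t : ℝ}
    (h : AccumulatesAt G t) : NonLocallyDiscreteAt G (t : S1) := by
  obtain ⟨r, hr, hacc⟩ := h
  have hε : ∀ n : ℕ, 0 < min (min (r / 8) (1 / 8)) (1 / ((n : ℝ) + 1)) := fun n => by positivity
  choose g hg hg1 F hF hFε using fun n : ℕ => hacc _ (hε n)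
  set r' := min (r / 2) (1 / 8) with hr'
  have hr'0 : 0 < r' := by positivity
  choose φ hφ hφd using fun n : ℕ => exists_univalent_extension hr (hF n) (hFε n)
    ((min_le_left _ _).trans (min_le_left _ _)) ((min_le_left _ _).trans (min_le_right _ _))
    (min_le_left (r / 2) (1 / 8)) (min_le_right (r / 2) (1 / 8))
  refine ⟨(fun z : ℂ => (z : Cyl)) '' Metric.ball (t : ℂ) r', ?_, ⟨t, Metric.mem_ball_self hr'0,
    (incl_coe t).symm⟩, g, φ, fun n => ⟨hg n, hg1 n⟩, hφ, ?_⟩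
  · exact QuotientAddGroup.isOpenMap_coe _ Metric.isOpen_ball
  · rw [Metric.tendstoUniformlyOn_iff]
    intro ε hε
    have h1 := (tendsto_one_div_add_atTop_nhds_zero_nat (𝕜 := ℝ)).eventually_lt_const hε
    filter_upwards [h1] with n hn y hy
    exact ((hφd n y hy).trans (min_le_right _ _)).trans_lt hn

end Cylinder

/-! ### Turning a height-raising self-map into a flow. -/

section Ascent

variable {V : Type*} {Γ : SimpleGraph V} {T : V → V} {β : V → ℝ} {a b : ℝ}

theorem add_mul_le_height_iterate (hT : ∀ v, β v + a ≤ β (T v)) (n : ℕ) (v : V) :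
    β v + n * a ≤ β (T^[n] v) := by
  induction n with
  | zero => simp
  | succ n ih =>
    rw [Function.iterate_succ_apply']
    have := hT (T^[n] v)
    push_cast
    linarith

theorem exists_le_height_iterate (ha : 0 < a) (hT : ∀ v, β v + a ≤ β (T v)) (t : ℝ) (v : V) :
    ∃ n, t ≤ β (T^[n] v) := by
  obtain ⟨n, hn⟩ := exists_nat_ge ((t - β v) / a)
  rw [div_le_iff₀ ha] at hn
  exact ⟨n, by linarith [add_mul_le_height_iterate hT n v]⟩

/-- The first iterate of `T` at `v` of height at least `t`. -/
noncomputable def ascend (T : V → V) (β : V → ℝ) (t : ℝ) (v : V) : V :=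
  T^[sInf {n | t ≤ β (T^[n] v)}] v

theorem le_height_ascend (ha : 0 < a) (hT : ∀ v, β v + a ≤ β (T v)) (t : ℝ) (v : V) :
    t ≤ β (ascend T β t v) :=
  Nat.sInf_mem (exists_le_height_iterate ha hT t v)

theorem ascend_of_le {t : ℝ} {v : V} (h : t ≤ β v) : ascend T β t v = v := by
  have : sInf {n | t ≤ β (T^[n] v)} = 0 := Nat.sInf_eq_zero.mpr (Or.inl h)
  rw [ascend, this, Function.iterate_zero, id]

theorem ascend_of_lt (ha : 0 < a) (hT : ∀ v, β v + a ≤ β (T v)) {t : ℝ} {v : V} (h : β v < t) :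
    ascend T β t v = ascend T β t (T v) := by
  have hne := exists_le_height_iterate ha hT t v
  have h1 : sInf {n | t ≤ β (T^[n] v)} = sInf {n | t ≤ β (T^[n] (T v))} + 1 := by
    refine le_antisymm (Nat.sInf_le ?_) ?_
    · exact Nat.sInf_mem (exists_le_height_iterate ha hT t (T v))
    · have h2 : t ≤ β (T^[sInf {n | t ≤ β (T^[n] v)}] v) := Nat.sInf_mem hne
      obtain ⟨k, hk⟩ : ∃ k, sInf {n | t ≤ β (T^[n] v)} = k + 1 := by
        refine Nat.exists_eq_succ_of_ne_zero fun h0 => ?_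
        rw [h0] at h2
        exact absurd h2 (not_le.mpr h)
      rw [hk] at h2 ⊢
      exact Nat.add_le_add_right (Nat.sInf_le h2) 1
  rw [ascend, h1, Function.iterate_succ_apply]
  rfl

theorem height_ascend_lt (ha : 0 < a) (hT : ∀ v, β v + a ≤ β (T v)) (hT' : ∀ v, β (T v) ≤ β v + b)
    {t : ℝ} {v : V} (h : β v < t) : β (ascend T β t v) < t + b := by
  have hne := exists_le_height_iterate ha hT t v
  have h2 : t ≤ β (T^[sInf {n | t ≤ β (T^[n] v)}] v) := Nat.sInf_mem hne
  obtain ⟨k, hk⟩ : ∃ k, sInf {n | t ≤ β (T^[n] v)} = k + 1 := by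
    refine Nat.exists_eq_succ_of_ne_zero fun h0 => ?_
    rw [h0] at h2
    exact absurd h2 (not_le.mpr h)
  have h3 : β (T^[k] v) < t := by
    have := Nat.notMem_of_lt_sInf (hk.symm ▸ Nat.lt_succ_self k :
      k < sInf {n | t ≤ β (T^[n] v)})
    simpa using this
  rw [ascend, hk, Function.iterate_succ_apply']
  linarith [hT' (T^[k] v)]

theorem ascend_ascend (ha : 0 < a) (hT : ∀ v, β v + a ≤ β (T v)) {s t : ℝ} (hst : s ≤ t) (v : V) :
    ascend T β t (ascend T β s v) = ascend T β t v := by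
  obtain ⟨n, hn⟩ := exists_le_height_iterate ha hT s v
  induction n generalizing v with
  | zero => rw [ascend_of_le (v := v) hn]
  | succ n ih =>
    rcases le_or_gt s (β v) with h | h
    · rw [ascend_of_le h]
    · rw [ascend_of_lt ha hT h, ascend_of_lt ha hT (h.trans_le hst)]
      exact ih (T v) hn

theorem dist_iterate_le (hc : Γ.Connected) {d₀ : ℕ} (hd : ∀ v, Γ.dist v (T v) ≤ d₀) (n : ℕ)
    (v : V) : Γ.dist v (T^[n] v) ≤ n * d₀ := by
  induction n with
  | zero => simp
  | succ n ih =>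
    rw [Function.iterate_succ_apply']
    have h1 := hd (T^[n] v)
    have h2 := hc.dist_triangle (u := v) (v := T^[n] v) (w := T (T^[n] v))
    have h3 : (n + 1) * d₀ = n * d₀ + d₀ := by ring
    omega

/-- A connected graph has thin triangles if it carries a self-map of bounded displacement that
raises a Lipschitz height and whose orbits get uniformly close to each other. -/
theorem hasThinTriangles_of_ascent (hc : Γ.Connected) {b' : ℝ} {d₀ D₀ : ℕ} (ha : 0 < a)
    (hT : ∀ v, β v + a ≤ β (T v)) (hT' : ∀ v, β (T v) ≤ β v + b)
    (hd : ∀ v, Γ.dist v (T v) ≤ d₀) (hadj : ∀ u v, Γ.Adj u v → |β u - β v| ≤ b')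
    (hmerge : ∀ K : ℕ, ∃ N : ℝ, ∀ u v, Γ.dist u v ≤ K → ∀ m n : ℕ, β u + N ≤ β (T^[m] u) →
      β v + N ≤ β (T^[n] v) → |β (T^[m] u) - β (T^[n] v)| ≤ b →
      Γ.dist (T^[m] u) (T^[n] v) ≤ D₀) :
    HasThinTriangles Γ := by
  obtain ⟨M, hM⟩ := exists_nat_ge (1 / a)
  obtain ⟨B, hB⟩ := exists_nat_ge b
  obtain ⟨B', hB'⟩ := exists_nat_ge b'
  refine hasThinTriangles_of_flow hc (fun t => ascend T β t) (fun v => ⌊β v⌋)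
    (M * d₀ + B + B' + 1) D₀ ?_ ?_ ?_ ?_ ?_ ?_
  · exact fun t v ht => ascend_of_le (Int.le_floor.mp ht)
  · intro t v
    rw [← ascend_ascend ha hT (t := ((t + 1 : ℤ) : ℝ)) (s := t) (by push_cast; linarith)]
    set w := ascend T β t v with hw
    have h1 : (t : ℝ) ≤ β w := le_height_ascend ha hT t v
    have h2 : sInf {n | ((t + 1 : ℤ) : ℝ) ≤ β (T^[n] w)} ≤ M := by
      refine Nat.sInf_le ?_
      have h3 := add_mul_le_height_iterate hT M w
      rw [div_le_iff₀ ha] at hM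
      change ((t + 1 : ℤ) : ℝ) ≤ β (T^[M] w)
      push_cast
      linarith
    have h3 := dist_iterate_le hc hd (sInf {n | ((t + 1 : ℤ) : ℝ) ≤ β (T^[n] w)}) w
    have h4 := Nat.mul_le_mul_right d₀ h2
    exact (h3.trans h4).trans (by omega)
  · exact fun s t v hst => ascend_ascend ha hT (by exact_mod_cast hst) v
  · intro s v
    rcases le_or_gt (s : ℝ) (β v) with h | h
    · rw [ascend_of_le h]; exact le_max_left _ _
    · refine le_max_of_le_right ?_
      have h1 := height_ascend_lt ha hT hT' h
      have h2 : ⌊β (ascend T β s v)⌋ ≤ s + B := by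
        have : ⌊β (ascend T β s v)⌋ ≤ ⌊((s + B : ℤ) : ℝ)⌋ := by
          apply Int.floor_mono; push_cast; linarith
        rwa [Int.floor_intCast] at this
      push_cast
      have : (0 : ℤ) ≤ M * d₀ := by positivity
      omega
  · intro u v huv
    have h1 := hadj u v huv
    have h2 : |((⌊β u⌋ - ⌊β v⌋ : ℤ) : ℝ)| < B' + 1 := by
      push_cast
      rw [abs_le] at h1
      rw [abs_lt]
      constructor <;> linarith [Int.floor_le (β u), Int.floor_le (β v), Int.lt_floor_add_one (β u),
        Int.lt_floor_add_one (β v)]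
    have h3 : |⌊β u⌋ - ⌊β v⌋| < (B' : ℤ) + 1 := by exact_mod_cast h2
    push_cast
    have : (0 : ℤ) ≤ M * d₀ := by positivity
    omega
  · intro K
    obtain ⟨N, hN⟩ := hmerge K
    obtain ⟨N', hN'⟩ := exists_nat_ge N
    refine ⟨N' + 1, fun u v huv t hu hv => ?_⟩
    have key : ∀ w : V, ⌊β w⌋ + ((N' + 1 : ℕ) : ℤ) ≤ t → β w < t ∧ β w + N ≤ t := by
      intro w hw
      have h1 : ((⌊β w⌋ + ((N' + 1 : ℕ) : ℤ) : ℤ) : ℝ) ≤ t := by exact_mod_cast hw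
      push_cast at h1
      have h2 := Int.lt_floor_add_one (β w)
      have h3 : (0 : ℝ) ≤ N' := by positivity
      constructor <;> linarith
    obtain ⟨hu1, hu2⟩ := key u hu
    obtain ⟨hv1, hv2⟩ := key v hv
    have h1 := le_height_ascend ha hT t u
    have h2 := le_height_ascend ha hT t v
    have h3 := height_ascend_lt ha hT hT' hu1
    have h4 := height_ascend_lt ha hT hT' hv1
    refine hN u v huv _ _ (hu2.trans h1) (hv2.trans h2) ?_
    change |β (ascend T β t u) - β (ascend T β t v)| ≤ b
    rw [abs_le]; constructor <;> linarith

end Ascent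

/-! ### Distances and balls in the Cayley graph. -/

section Cayley

variable {G : Type*} [Group G] {S : Set G}

theorem cayleyGraph_adj_mul {s u : G} (hs : s ∈ S) (hne : s * u ≠ u) :
    (cayleyGraph S).Adj u (s * u) := by
  rw [cayleyGraph, SimpleGraph.fromRel_adj]
  exact ⟨hne.symm, Or.inl ⟨s, hs, rfl⟩⟩

theorem exists_eq_mul_of_adj (hS : ∀ s ∈ S, s⁻¹ ∈ S) {u v : G} (h : (cayleyGraph S).Adj u v) :
    ∃ s ∈ S, v = s * u := by
  rw [cayleyGraph, SimpleGraph.fromRel_adj] at h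
  obtain ⟨-, ⟨s, hs, rfl⟩ | ⟨s, hs, rfl⟩⟩ := h
  · exact ⟨s, hs, rfl⟩
  · exact ⟨s⁻¹, hS s hs, by group⟩

theorem exists_walk_mul (hcl : Subgroup.closure S = ⊤) (f : G) :
    ∃ k, ∀ u, ∃ p : (cayleyGraph S).Walk u (f * u), p.length ≤ k := by
  have hf : f ∈ Subgroup.closure S := hcl ▸ Subgroup.mem_top f
  induction hf using Subgroup.closure_induction with
  | mem s hs =>
    refine ⟨1, fun u => ?_⟩
    by_cases h : s * u = u
    · exact ⟨SimpleGraph.Walk.nil.copy rfl h.symm, by simp⟩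
    · exact ⟨(cayleyGraph_adj_mul hs h).toWalk, by simp⟩
  | one => exact ⟨0, fun u => ⟨SimpleGraph.Walk.nil.copy rfl (one_mul u).symm, by simp⟩⟩
  | mul f g _ _ hf hg =>
    obtain ⟨k, hk⟩ := hf
    obtain ⟨l, hl⟩ := hg
    refine ⟨l + k, fun u => ?_⟩
    obtain ⟨p, hp⟩ := hl u
    obtain ⟨q, hq⟩ := hk (g * u)
    refine ⟨(p.append q).copy rfl (mul_assoc f g u).symm, ?_⟩
    rw [SimpleGraph.Walk.length_copy, SimpleGraph.Walk.length_append]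
    omega
  | inv f _ hf =>
    obtain ⟨k, hk⟩ := hf
    refine ⟨k, fun u => ?_⟩
    obtain ⟨p, hp⟩ := hk (f⁻¹ * u)
    refine ⟨p.reverse.copy (mul_inv_cancel_left f u) rfl, ?_⟩
    rw [SimpleGraph.Walk.length_copy, SimpleGraph.Walk.length_reverse]
    exact hp

theorem cayleyGraph_connected (hcl : Subgroup.closure S = ⊤) : (cayleyGraph S).Connected := by
  rw [SimpleGraph.connected_iff_exists_forall_reachable]
  refine ⟨1, fun f => ?_⟩
  obtain ⟨k, hk⟩ := exists_walk_mul hcl f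
  obtain ⟨p, -⟩ := hk 1
  exact ⟨p.copy rfl (mul_one f)⟩

/-- Edges are left multiplications, so a word for f gives a walk from u to fu of the same length for
every u. This turns finiteness of the transitions into the bound `D₀`. -/
theorem exists_dist_mul_le (hcl : Subgroup.closure S = ⊤) {F : Set G} (hF : F.Finite) :
    ∃ k, ∀ f ∈ F, ∀ u, (cayleyGraph S).dist u (f * u) ≤ k := by
  choose k hk using exists_walk_mul hcl
  obtain ⟨K, hK⟩ := (hF.image k).bddAbove
  refine ⟨K, fun f hf u => ?_⟩
  obtain ⟨p, hp⟩ := hk f u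
  exact (SimpleGraph.dist_le p).trans (hp.trans (hK ⟨f, hf, rfl⟩))

theorem exists_finite_ball (hSf : S.Finite) (hS : ∀ s ∈ S, s⁻¹ ∈ S)
    (hcl : Subgroup.closure S = ⊤) (K : ℕ) :
    ∃ B : Set G, B.Finite ∧ ∀ u v, (cayleyGraph S).dist u v ≤ K → ∃ f ∈ B, v = f * u := by
  suffices h : ∃ B : Set G, B.Finite ∧ ∀ u v (p : (cayleyGraph S).Walk u v), p.length ≤ K →
      ∃ f ∈ B, v = f * u by
    obtain ⟨B, hB, h⟩ := h
    refine ⟨B, hB, fun u v huv => ?_⟩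
    obtain ⟨p, hp⟩ := (cayleyGraph_connected hcl).exists_walk_length_eq_dist u v
    exact h u v p (hp.trans_le huv)
  induction K with
  | zero =>
    refine ⟨{1}, finite_singleton 1, fun u v p hp => ⟨1, rfl, ?_⟩⟩
    rw [one_mul]
    exact (SimpleGraph.Walk.eq_of_length_eq_zero (Nat.le_zero.mp hp)).symm
  | succ K ih =>
    obtain ⟨B, hB, h⟩ := ih
    refine ⟨B ∪ image2 (fun f s => f * s) B S, hB.union (hB.image2 _ hSf), fun u v p hp => ?_⟩
    cases p with
    | nil =>
      obtain ⟨f, hf, hfv⟩ := h u u SimpleGraph.Walk.nil (by simp)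
      exact ⟨f, Or.inl hf, hfv⟩
    | cons hadj q =>
      rw [SimpleGraph.Walk.length_cons] at hp
      obtain ⟨s, hs, rfl⟩ := exists_eq_mul_of_adj hS hadj
      obtain ⟨f, hf, rfl⟩ := h _ _ q (by omega)
      exact ⟨f * s, Or.inr ⟨f, hf, s, hs, rfl⟩, (mul_assoc f s u).symm⟩

end Cayley

/-! ### Finitely many transitions, and distortion along expanding itineraries. -/

section Dynamics

/-- The transitions `b₂⁻¹ b₁` between nearly linear elements with a common value and comparable
derivatives, based at points of the orbit of `x`. -/
def transitions (G : Subgroup DiffAn) (x : S1) (ρ E : ℝ) : Set DiffAn :=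
  {c | ∃ b₁ ∈ G, ∃ b₂ ∈ G, ∃ y₁ y₂ : S1, (∃ u ∈ G, u.app x = y₁) ∧
    Good ρ (1 / 2) b₁ y₁ ∧ Good ρ (1 / 2) b₂ y₂ ∧ b₁.app y₁ = b₂.app y₂ ∧
    |b₁.D y₁| ≤ E * |b₂.D y₂| ∧ |b₂.D y₂| ≤ E * |b₁.D y₁| ∧ c = b₂⁻¹ * b₁}

/-- Discreteness is assumed at x only; since the centres lie on the orbit of x, an accumulation
there is conjugated back to x by an element of G. -/
theorem finite_transitions {G : Subgroup DiffAn} {x : S1} (hx : LocallyDiscreteAt G x) {ρ E : ℝ}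
    (hρ : 0 < ρ) (hE : 1 ≤ E) : (transitions G x ρ E).Finite := by
  by_contra hinf
  obtain ⟨t₀, rfl⟩ := QuotientAddGroup.mk_surjective x
  obtain ⟨t, ⟨u, hu, hut⟩, hacc⟩ := accumulatesAt_of_infinite_tame (G := G)
    (X := transitions G (t₀ : S1) ρ E) (κ := ρ / (12 * E)) (L := 3 * E)
    (P := fun y => ∃ u ∈ G, u.app (t₀ : S1) = y)
    (by rintro c ⟨b₁, h₁, b₂, h₂, -, -, -, -, -, -, -, -, rfl⟩
        exact G.mul_mem (G.inv_mem h₂) h₁)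
    hinf (by positivity) (by linarith) (by
      rintro c ⟨b₁, -, b₂, -, y₁, y₂, hy, h₁, h₂, hb, h₁₂, h₂₁, rfl⟩
      obtain ⟨t, s, C, C', ht, htame⟩ := exists_tame hρ hE h₁ h₂ hb h₁₂ h₂₁
      exact ⟨t, s, C, C', ht ▸ hy, htame⟩)
  exact hx (hacc.of_app_eq hu hut).nonLocallyDiscreteAt

theorem IsExpanding.exists_uniform {G : Subgroup DiffAn} (hG : IsExpanding G) :
    ∃ S₀ : Set DiffAn, S₀.Finite ∧ (∀ g ∈ S₀, g ∈ G) ∧ ∃ l > 1, ∃ M, ∃ σ : S1 → DiffAn,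
      ∀ y, σ y ∈ S₀ ∧ l ≤ |(σ y).D y| ∧ |(σ y).D y| ≤ M := by
  have := (isCompact_univ (X := S1)).induction_on
    (p := fun s => ∃ S₀ : Set DiffAn, S₀.Finite ∧ (∀ g ∈ S₀, g ∈ G) ∧ ∃ l > 1,
      ∀ y ∈ s, ∃ g ∈ S₀, l ≤ |g.D y|)
    ⟨∅, finite_empty, by simp, 2, by norm_num, by simp⟩ ?_ ?_ ?_
  · obtain ⟨S₀, hfin, hSG, l, hl, h⟩ := this
    choose M hM using DiffAn.exists_abs_D_le
    obtain ⟨K, hK⟩ := (hfin.image M).bddAbove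
    choose σ hσ hσl using fun y => h y (mem_univ y)
    exact ⟨S₀, hfin, hSG, l, hl, K, σ, fun y => ⟨hσ y, hσl y,
      (hM _ y).trans (hK ⟨_, hσ y, rfl⟩)⟩⟩
  · rintro s t hst ⟨S₀, hfin, hSG, l, hl, h⟩
    exact ⟨S₀, hfin, hSG, l, hl, fun y hy => h y (hst hy)⟩
  · rintro s t ⟨S₀, hfin, hSG, l, hl, h⟩ ⟨S₀', hfin', hSG', l', hl', h'⟩
    refine ⟨S₀ ∪ S₀', hfin.union hfin', fun g hg => hg.elim (hSG g) (hSG' g), min l l',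
      lt_min hl hl', fun y hy => ?_⟩
    rcases hy with hy | hy
    · obtain ⟨g, hg, hgl⟩ := h y hy
      exact ⟨g, Or.inl hg, (min_le_left _ _).trans hgl⟩
    · obtain ⟨g, hg, hgl⟩ := h' y hy
      exact ⟨g, Or.inr hg, (min_le_right _ _).trans hgl⟩
  · intro y _
    obtain ⟨g, hg, hlog⟩ := hG y
    have h1 : 1 < |g.D y| := by
      by_contra! h
      exact absurd hlog (not_lt.mpr (Real.log_nonpos (abs_nonneg _) h))
    obtain ⟨l, hl, hl'⟩ := exists_between h1
    have h2 : ∀ᶠ y' in 𝓝 y, l < |g.D y'| :=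
      g.continuous_D.abs.continuousAt.eventually_const_lt hl'
    exact ⟨_, mem_nhdsWithin_of_mem_nhds h2, {g}, finite_singleton g, by simpa using hg, l, hl,
      fun y' hy' => ⟨g, rfl, le_of_lt hy'⟩⟩

/-- The product of the first `n` elements chosen by `σ` along the orbit of `y`. -/
def itinerary (σ : S1 → DiffAn) : ℕ → S1 → DiffAn
  | 0, _ => 1
  | n + 1, y => itinerary σ n ((σ y).app y) * σ y

theorem DiffAn.inv_app_app (g : DiffAn) (y : S1) : (g⁻¹ : DiffAn).app (g.app y) = y :=
  Equiv.symm_apply_apply (g : Equiv.Perm S1) y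

/-- Inverses of expanding itineraries are uniformly nearly linear. -/
theorem exists_good_itinerary {S₀ : Set DiffAn} (hS₀ : S₀.Finite) {l : ℝ} (hl : 1 < l)
    {σ : S1 → DiffAn} (hσ : ∀ y, σ y ∈ S₀ ∧ l ≤ |(σ y).D y|) :
    ∃ r > 0, ∀ n y, Good r (1 / 4) (itinerary σ n y)⁻¹ ((itinerary σ n y).app y) := by
  obtain ⟨ρ, hρ, C, hC, hgood⟩ := exists_good_of_finite (hS₀.image fun g => g⁻¹)
  obtain ⟨q, hq⟩ : ∃ q, q = 1 / l := ⟨_, rfl⟩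
  have hq0 : 0 < q := by rw [hq]; positivity
  have hq1 : q < 1 := by rw [hq, div_lt_one (by linarith)]; exact hl
  have hq1' : 0 < 1 - q := by linarith
  have hlog : 0 < Real.log (5 / 4) := Real.log_pos (by norm_num)
  set r := min (ρ / 2) (Real.log (5 / 4) * (1 - q) / (2 * (C + 1))) with hr
  have hr0 : 0 < r := by positivity
  -- Total logarithmic distortion: the image of the ball after n inverse steps has radius at most
  -- 2rqⁿ, so the next step contributes at most 2Crqⁿ, and E is the sum of this series. The choice
  -- of r makes exp E ≤ 5/4.
  set E := 2 * C * r / (1 - q) with hE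
  have hE0 : 0 ≤ E := by positivity
  have hE1 : Real.exp E ≤ 5 / 4 := by
    rw [← Real.le_log_iff_exp_le (by norm_num), hE, div_le_iff₀ hq1']
    calc 2 * C * r ≤ 2 * (C + 1) * (Real.log (5 / 4) * (1 - q) / (2 * (C + 1))) := by
          gcongr
          · linarith
          · exact min_le_right _ _
      _ = _ := by field_simp
  have hEq : E * (1 - q) = 2 * C * r := by rw [hE]; field_simp
  have hexp : ∀ n : ℕ, Real.exp (E * (1 - q ^ n)) ≤ 5 / 4 := by
    intro n
    refine le_trans (Real.exp_le_exp.mpr ?_) hE1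
    have : 0 < q ^ n := by positivity
    nlinarith
  have hexp1 : ∀ n : ℕ, 1 ≤ Real.exp (E * (1 - q ^ n)) := by
    intro n
    refine Real.one_le_exp (mul_nonneg hE0 ?_)
    linarith [pow_le_one₀ (n := n) hq0.le hq1.le]
  have key : ∀ n y, Good r (Real.exp (E * (1 - q ^ n)) - 1) (itinerary σ n y)⁻¹
        ((itinerary σ n y).app y) ∧
      |(itinerary σ n y)⁻¹.D ((itinerary σ n y).app y)| ≤ q ^ n := by
    intro n
    induction n with
    | zero =>
      intro y
      have h1 : ((itinerary σ 0 y)⁻¹ : DiffAn) = 1 := inv_one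
      rw [h1, DiffAn.D_one]
      exact ⟨by simpa using Good.one _, by simp⟩
    | succ n ih =>
      intro y
      set y₁ := (σ y).app y with hy₁
      obtain ⟨h1, h2⟩ := ih y₁
      have hinv : (itinerary σ (n + 1) y)⁻¹ = (σ y)⁻¹ * (itinerary σ n y₁)⁻¹ := by
        rw [itinerary, mul_inv_rev]
      have happ : (itinerary σ (n + 1) y).app y = (itinerary σ n y₁).app y₁ := rfl
      rw [hinv, happ]
      have hback : ((itinerary σ n y₁)⁻¹ : DiffAn).app ((itinerary σ n y₁).app y₁) = y₁ :=
        DiffAn.inv_app_app _ _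
      have hqn0 : 0 < q ^ n := by positivity
      constructor
      · have h3 : Good (2 * r * q ^ n) (C * (2 * r * q ^ n)) (σ y)⁻¹
            (((itinerary σ n y₁)⁻¹ : DiffAn).app ((itinerary σ n y₁).app y₁)) := by
          refine hgood _ ⟨_, (hσ y).1, rfl⟩ _ _ ?_ (by positivity)
          have h4 : q ^ n ≤ 1 := pow_le_one₀ hq0.le hq1.le
          have h5 : r ≤ ρ / 2 := min_le_left _ _
          nlinarith
        refine (Good.mul (by linarith [hexp1 n]) (by positivity) hr0 h1 h3 ?_).mono le_rfl ?_
        · have h6 := hexp n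
          calc (1 + (Real.exp (E * (1 - q ^ n)) - 1)) *
                |(itinerary σ n y₁)⁻¹.D ((itinerary σ n y₁).app y₁)| * r
              ≤ 2 * q ^ n * r := by
                gcongr
                linarith
            _ = _ := by ring
        · have h7 : 1 + C * (2 * r * q ^ n) ≤ Real.exp (C * (2 * r * q ^ n)) := by
            linarith [Real.add_one_le_exp (C * (2 * r * q ^ n))]
          have h8 : Real.exp (E * (1 - q ^ (n + 1))) =
              Real.exp (E * (1 - q ^ n)) * Real.exp (C * (2 * r * q ^ n)) := by
            rw [← Real.exp_add]
            congr 1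
            calc E * (1 - q ^ (n + 1)) = E * (1 - q ^ n) + E * (1 - q) * q ^ n := by ring
              _ = _ := by rw [hEq]; ring
          rw [h8]
          have := mul_le_mul_of_nonneg_left h7 (Real.exp_pos (E * (1 - q ^ n))).le
          linarith
      · rw [DiffAn.D_mul, hback, abs_mul, pow_succ, mul_comm (q ^ n)]
        refine mul_le_mul ?_ h2 (abs_nonneg _) hq0.le
        have h3 := congrArg abs ((σ y).D_inv_mul y)
        rw [abs_mul, abs_one] at h3
        have h4 : 0 < |(σ y).D y| := abs_pos.mpr ((σ y).D_ne_zero y)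
        rw [eq_div_of_mul_eq h4.ne' h3, hq]
        exact one_div_le_one_div_of_le (by linarith) (hσ y).2
  exact ⟨r, hr0, fun n y => (key n y).1.mono le_rfl (by linarith [hexp n])⟩

end Dynamics

/-! ### Merging of orbits and conclusion. -/

section Main

/-- The height `log |Dg(x)|` of a diffeomorphism, seen from the point `x`. -/
noncomputable def DiffAn.height (x : S1) (g : DiffAn) : ℝ := Real.log |g.D x|

theorem DiffAn.height_mul (x : S1) (h g : DiffAn) :
    (h * g).height x = Real.log |h.D (g.app x)| + g.height x := by
  rw [height, D_mul, abs_mul, Real.log_mul (abs_ne_zero.mpr (h.D_ne_zero _))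
    (abs_ne_zero.mpr (g.D_ne_zero _)), height]

theorem DiffAn.abs_D_app (x : S1) (h g : DiffAn) :
    |h.D (g.app x)| = Real.exp ((h * g).height x - g.height x) := by
  rw [height_mul, add_sub_cancel_right, Real.exp_log (abs_pos.mpr (h.D_ne_zero _))]

theorem DiffAn.exists_height_mul_sub_le (x : S1) {F : Set DiffAn} (hF : F.Finite) :
    ∃ b, ∀ f ∈ F, ∀ g : DiffAn, |(f * g).height x - g.height x| ≤ b := by
  have hbd : ∀ f : DiffAn, ∃ b, ∀ y, |(Real.log |f.D y|)| ≤ b := by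
    intro f
    have hc : Continuous fun y => |(Real.log |f.D y|)| :=
      (f.continuous_D.abs.log fun y => abs_ne_zero.mpr (f.D_ne_zero y)).abs
    obtain ⟨b, hb⟩ := (isCompact_range hc).bddAbove
    exact ⟨b, fun y => hb ⟨y, rfl⟩⟩
  choose b hb using hbd
  obtain ⟨B, hB⟩ := (hF.image b).bddAbove
  refine ⟨B, fun f hf g => ?_⟩
  rw [height_mul, add_sub_cancel_right]
  exact (hb f _).trans (hB ⟨f, hf, rfl⟩)

/-- Nearly linear inverse itineraries stay nearly linear after composition with the elements of a
finite set, once they contract enough. -/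
theorem exists_good_mul_of_finite {F : Set DiffAn} (hF : F.Finite) {r : ℝ} (hr : 0 < r) :
    ∃ N : ℝ, ∀ f ∈ F, ∀ (b : DiffAn) (y : S1), Good r (1 / 4) b y → |b.D y| ≤ Real.exp (-N) →
      Good r (1 / 2) (f * b) y := by
  obtain ⟨ρ, hρ, C, hC, hgood⟩ := exists_good_of_finite hF
  set s := min ρ (1 / (5 * (C + 1))) with hs
  have hs0 : 0 < s := by positivity
  have hCs : C * s ≤ 1 / 5 := by
    calc C * s ≤ (C + 1) * (1 / (5 * (C + 1))) := by
          gcongr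
          · linarith
          · exact min_le_right _ _
      _ = 1 / 5 := by field_simp
  -- With this N, the ball of radius r is sent by b into one of radius s, where f has error at most
  -- 1/5; then (5/4)(6/5) - 1 = 1/2.
  refine ⟨-Real.log (s / (2 * r)), fun f hf b y hb hD => ?_⟩
  rw [neg_neg, Real.exp_log (by positivity), le_div_iff₀ (by positivity)] at hD
  refine (hb.mul (by norm_num) (by norm_num) hr
    ((hgood f hf (b.app y) s (min_le_left _ _) hs0).mono le_rfl hCs) ?_).mono le_rfl (by norm_num)
  have : 0 ≤ |b.D y| * r := by positivity
  linarith

theorem iterate_eq_itinerary {σ : S1 → DiffAn} {x : S1} {G : Subgroup DiffAn} (hσ : ∀ y, σ y ∈ G)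
    (n : ℕ) (u : G) :
    (((fun v : G => (⟨σ (v.1.app x), hσ _⟩ : G) * v)^[n] u : G) : DiffAn) =
      itinerary σ n (u.1.app x) * u.1 := by
  induction n generalizing u with
  | zero => exact (one_mul _).symm
  | succ n ih =>
    rw [Function.iterate_succ_apply, ih]
    exact (mul_assoc _ _ _).symm

theorem hasThinTriangles_cayleyGraph {G : Subgroup DiffAn} (hexp : IsExpanding G) {x : S1}
    (hx : LocallyDiscreteAt G x) {S : Set G} (hSf : S.Finite) (hS : ∀ s ∈ S, s⁻¹ ∈ S)
    (hcl : Subgroup.closure S = ⊤) : HasThinTriangles (cayleyGraph S) := by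
  obtain ⟨S₀, hS₀, hS₀G, l, hl, M, σ, hσ⟩ := hexp.exists_uniform
  obtain ⟨r, hr, hgood⟩ := exists_good_itinerary hS₀ hl fun y => ⟨(hσ y).1, (hσ y).2.1⟩
  have hσG : ∀ y, σ y ∈ G := fun y => hS₀G _ (hσ y).1
  have hM : 1 < M := hl.trans_le ((hσ x).2.1.trans (hσ x).2.2)
  set T : G → G := fun v => (⟨σ (v.1.app x), hσG _⟩ : G) * v with hT
  have hiter : ∀ n (u : G), ((T^[n] u : G) : DiffAn) = itinerary σ n (u.1.app x) * u.1 :=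
    fun n u => iterate_eq_itinerary hσG n u
  have hTh : ∀ v : G, (T v).1.height x = Real.log |(σ (v.1.app x)).D (v.1.app x)| +
      v.1.height x := fun v => DiffAn.height_mul x _ _
  have hX := finite_transitions hx hr (Real.one_le_exp (Real.log_pos hM).le)
  obtain ⟨D₀, hD₀⟩ := exists_dist_mul_le hcl (hX.preimage (f := ((↑) : G → DiffAn))
    Subtype.val_injective.injOn)
  obtain ⟨d₀, hd₀⟩ := exists_dist_mul_le hcl (hS₀.preimage (f := ((↑) : G → DiffAn))
    Subtype.val_injective.injOn)
  obtain ⟨b', hb'⟩ := DiffAn.exists_height_mul_sub_le x (hSf.image ((↑) : G → DiffAn))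
  refine hasThinTriangles_of_ascent (T := T) (β := fun u => u.1.height x) (a := Real.log l)
    (b := Real.log M) (b' := b') (d₀ := d₀) (D₀ := D₀) (cayleyGraph_connected hcl)
    (Real.log_pos hl) ?_ ?_ ?_ ?_ ?_
  · intro v
    have := Real.log_le_log (by linarith) (hσ (v.1.app x)).2.1
    rw [hTh]; linarith
  · intro v
    have := Real.log_le_log (abs_pos.mpr (DiffAn.D_ne_zero _ _)) (hσ (v.1.app x)).2.2
    rw [hTh]; linarith
  · exact fun v => hd₀ _ (hσ _).1 v
  · intro u v huv
    obtain ⟨s, hs, rfl⟩ := exists_eq_mul_of_adj hS huv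
    rw [abs_sub_comm]
    exact hb' _ ⟨s, hs, rfl⟩ u.1
  · intro K
    obtain ⟨B, hBf, hB⟩ := exists_finite_ball hSf hS hcl K
    obtain ⟨N, hN⟩ := exists_good_mul_of_finite
      (hBf.image fun f : G => (f.1⁻¹ : DiffAn)) hr
    refine ⟨max N 0, fun u v huv m n hu hv hh => ?_⟩
    obtain ⟨f, hf, rfl⟩ := hB u v huv
    set v : G := f * u with hvdef
    obtain ⟨A, hA⟩ : ∃ A, A = itinerary σ m (u.1.app x) := ⟨_, rfl⟩
    obtain ⟨A', hA'⟩ : ∃ A', A' = itinerary σ n (v.1.app x) := ⟨_, rfl⟩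
    have hu1 : ((T^[m] u : G) : DiffAn) = A * u.1 := hA ▸ hiter m u
    have hv1 : ((T^[n] v : G) : DiffAn) = A' * v.1 := hA' ▸ hiter n v
    have hg1 : Good r (1 / 4) A⁻¹ ((A * u.1 : DiffAn).app x) := hA ▸ hgood m (u.1.app x)
    have hg2 : Good r (1 / 4) A'⁻¹ ((A' * v.1 : DiffAn).app x) := hA' ▸ hgood n (v.1.app x)
    simp only [hu1, hv1] at hu hv hh
    have e1 : (A⁻¹ * (A * u.1) : DiffAn) = u.1 := by group
    have e2 : (A'⁻¹ * (A' * v.1) : DiffAn) = v.1 := by group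
    have e3 : ((f.1⁻¹ * A'⁻¹) * (A' * v.1) : DiffAn) = u.1 := by
      rw [hvdef, Subgroup.coe_mul]; group
    have d1 := DiffAn.abs_D_app x A⁻¹ (A * u.1)
    have d2 := DiffAn.abs_D_app x A'⁻¹ (A' * v.1)
    have d3 := DiffAn.abs_D_app x (f.1⁻¹ * A'⁻¹) (A' * v.1)
    rw [e1] at d1
    rw [e2] at d2
    rw [e3] at d3
    have hg3 : Good r (1 / 2) (f.1⁻¹ * A'⁻¹) ((A' * v.1 : DiffAn).app x) := by
      refine hN _ ⟨f, hf, rfl⟩ _ _ hg2 ?_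
      rw [d2]
      apply Real.exp_le_exp.mpr
      linarith [le_max_left N 0]
    have hAG : A ∈ G := by
      have : A = (T^[m] u : G).1 * u.1⁻¹ := by rw [hu1]; group
      rw [this]
      exact G.mul_mem (T^[m] u).2 (G.inv_mem u.2)
    have hAG' : A' ∈ G := by
      have : A' = (T^[n] v : G).1 * v.1⁻¹ := by rw [hv1]; group
      rw [this]
      exact G.mul_mem (T^[n] v).2 (G.inv_mem v.2)
    rw [abs_le] at hh
    -- Both branches lead back to u, so by the chain rule the logarithms of their derivatives differ
    -- exactly by the gap between the two heights reached, at most log M. Absorbing f into the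
    -- second branch makes this set of transitions independent of K.
    have hmem : ((f.1⁻¹ * A'⁻¹)⁻¹ * A⁻¹ : DiffAn) ∈
        transitions G x r (Real.exp (Real.log M)) := by
      refine ⟨A⁻¹, G.inv_mem hAG, f.1⁻¹ * A'⁻¹, G.mul_mem (G.inv_mem f.2) (G.inv_mem hAG'), _, _,
        ⟨A * u.1, G.mul_mem hAG u.2, rfl⟩, hg1.mono le_rfl (by norm_num), hg3, ?_, ?_, ?_, rfl⟩
      · change (A⁻¹ * (A * u.1) : DiffAn).app x = ((f.1⁻¹ * A'⁻¹) * (A' * v.1) : DiffAn).app x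
        rw [e1, e3]
      · rw [d1, d3, ← Real.exp_add]
        apply Real.exp_le_exp.mpr
        linarith
      · rw [d1, d3, ← Real.exp_add]
        apply Real.exp_le_exp.mpr
        linarith
    have hc : T^[n] v = (⟨(f.1⁻¹ * A'⁻¹)⁻¹ * A⁻¹, G.mul_mem (G.inv_mem (G.mul_mem (G.inv_mem f.2)
        (G.inv_mem hAG'))) (G.inv_mem hAG)⟩ : G) * T^[m] u := by
      apply Subtype.ext
      rw [Subgroup.coe_mul, hu1, hv1, hvdef, Subgroup.coe_mul]
      group
    rw [hc]
    exact hD₀ _ hmem _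

end Main

end CircleDyn

theorem mainTheorem4 (G : Subgroup CircleDyn.DiffAn) (hfg : G.FG)
    (hexp : CircleDyn.IsExpanding G) (hld : CircleDyn.IsLocallyDiscrete G) :
    CircleDyn.IsGromovHyperbolic ↥G := by
  obtain ⟨x, hx⟩ := hld
  exact ⟨(Group.fg_iff_subgroup_fg G).mpr hfg, fun S hSf hS hcl =>
    CircleDyn.hasThinTriangles_cayleyGraph hexp hx hSf hS hcl⟩
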